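/- Let $d\ge 1$ and let $L^0(\mathbf R^d)$ be the space of (real- or complex-valued) measurable functions modulo a.e. equality. A quasi-Banach function space over $\mathbf R^d$ is a complete quasi-normed vector space $X\subseteq L^0(\mathbf R^d)$ such that (ideal property) if $f\in X$, $g\in L^0(\mathbf R^d)$ and $|g|\le|f|$ a.e., then $g\in X$ and $\|g\|_X\le\|f\|_X$; and (saturation property) every measurable $E$ with $|E|>0$ contains a measurable $F$ with $|F|>0$ and $\mathbf 1_F\in X$. Let $K_X\ge1$ be the optimal constant in $\|f+g\|_X\le K_X(\|f\|_X+\|g\|_X)$ for $f,g\in X$. For $0<r<\infty$ put $$X^r:=\{f\in L^0(\mathbf R^d):|f|^{1/r}\in X\},\qquad \|f\|_{X^r}:=\big\||f|^{1/r}\big\|_X^r.$$ Cubes have sides parallel to the coordinate axes. A (finite or infinite) collection $\mathcal S$ of cubes is called sparse if there are pairwise disjoint measurable sets $E_Q\subseteq Q$, $Q\in\mathcal S$, with $|E_Q|\ge\frac12|Q|$; put $$A_{\mathcal S}f:=\sum_{Q\in\mathcal S}\Big(\frac1{|Q|}\int_Q|f|\,dx\Big)\mathbf 1_Q.$$ We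 write $X\in A_{\text{sparse}}$ if there is a $C>0$ such that for every sparse collection $\mathcal S$ and every $f\in X$ we have $A_{\mathcal S}f\in X$ and $\|A_{\mathcal S}f\|_X\le C\|f\|_X$; the smallest such $C$ is denoted by $[X]_{A_{\text{sparse}}}$. The same definition is used for $X^r$. **Theorem.** For every integer $d\ge1$ and every real $K\ge1$ there is a constant $c_{d,K}>0$ such that the following holds. Let $X$ be a quasi-Banach function space over $\mathbf R^d$ with $X\in A_{\text{sparse}}$. Then there is an $r_0>1$ such that for every $1<r\le r_0$ we have $X^r\in A_{\text{sparse}}$ and $$[X^r]_{A_{\text{sparse}}}^{1/r}\le c_{d,K_X}\,[X]_{A_{\text{sparse}}}.$$ -/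

import Mathlib

open MeasureTheory Filter Topology
open scoped ENNReal

noncomputable section

/-- A collection `carrier` of (a.e. classes of) measurable functions on `(Ω, μ)`, together with a
functional `qnorm`; only the values of `qnorm` on `carrier` are ever used. -/
structure FunctionSpace (𝕜 : Type*) [RCLike 𝕜] {Ω : Type*} [MeasurableSpace Ω]
    (μ : Measure Ω) where
  carrier : Set (Ω →ₘ[μ] 𝕜)
  qnorm : (Ω →ₘ[μ] 𝕜) → ℝ

namespace FunctionSpace

/-- `K ≥ 1` is an admissible constant in the quasi-triangle inequality of `X`. -/
def QuasiTriangle {𝕜 : Type*} [RCLike 𝕜] {Ω : Type*} [MeasurableSpace Ω] {μ : Measure Ω}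
    (X : FunctionSpace 𝕜 μ) (K : ℝ) : Prop :=
  1 ≤ K ∧ ∀ f ∈ X.carrier, ∀ g ∈ X.carrier, X.qnorm (f + g) ≤ K * (X.qnorm f + X.qnorm g)

/-- The optimal constant `K_X ≥ 1` in the quasi-triangle inequality of `X`. -/
def quasiConst {𝕜 : Type*} [RCLike 𝕜] {Ω : Type*} [MeasurableSpace Ω] {μ : Measure Ω}
    (X : FunctionSpace 𝕜 μ) : ℝ :=
  sInf {K : ℝ | X.QuasiTriangle K}

/-- `X` is a quasi-Banach function space over `(Ω, μ)`: a complete quasi-normed vector space of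
measurable functions with the ideal property and the saturation property. -/
structure IsQuasiBanach {𝕜 : Type*} [RCLike 𝕜] {Ω : Type*} [MeasurableSpace Ω] {μ : Measure Ω}
    (X : FunctionSpace 𝕜 μ) : Prop where
  zero_mem : (0 : Ω →ₘ[μ] 𝕜) ∈ X.carrier
  add_mem : ∀ f ∈ X.carrier, ∀ g ∈ X.carrier, f + g ∈ X.carrier
  smul_mem : ∀ (c : 𝕜), ∀ f ∈ X.carrier, c • f ∈ X.carrier
  qnorm_nonneg : ∀ f ∈ X.carrier, 0 ≤ X.qnorm f
  qnorm_eq_zero_iff : ∀ f ∈ X.carrier, (X.qnorm f = 0 ↔ f = 0)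
  qnorm_smul : ∀ (c : 𝕜), ∀ f ∈ X.carrier, X.qnorm (c • f) = ‖c‖ * X.qnorm f
  quasi_triangle : ∃ K : ℝ, X.QuasiTriangle K
  complete : ∀ u : ℕ → (Ω →ₘ[μ] 𝕜), (∀ n, u n ∈ X.carrier) →
    (∀ ε : ℝ, 0 < ε → ∃ N : ℕ, ∀ m ≥ N, ∀ n ≥ N, X.qnorm (u m - u n) < ε) →
    ∃ f ∈ X.carrier, Tendsto (fun n => X.qnorm (u n - f)) atTop (𝓝 0)
  ideal : ∀ f ∈ X.carrier, ∀ g : Ω →ₘ[μ] 𝕜, (∀ᵐ x ∂μ, ‖g x‖ ≤ ‖f x‖) →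
    g ∈ X.carrier ∧ X.qnorm g ≤ X.qnorm f
  saturation : ∀ E : Set Ω, MeasurableSet E → 0 < μ E →
    ∃ F : Set Ω, F ⊆ E ∧ MeasurableSet F ∧ 0 < μ F ∧
      ∃ h ∈ X.carrier, (h : Ω → 𝕜) =ᵐ[μ] F.indicator (fun _ => (1 : 𝕜))

end FunctionSpace

/-- The class of the function `x ↦ |f x| ^ s`. -/
def absPow {𝕜 : Type*} [RCLike 𝕜] {Ω : Type*} [MeasurableSpace Ω] {μ : Measure Ω}
    (s : ℝ) (f : Ω →ₘ[μ] 𝕜) : Ω →ₘ[μ] 𝕜 :=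
  AEEqFun.compMeasurable (fun t : 𝕜 => ((‖t‖ ^ s : ℝ) : 𝕜))
    (RCLike.measurable_ofReal.comp (measurable_norm.pow_const s)) f

/-- The `p`-concavification `X ^ p = {f : |f| ^ (1 / p) ∈ X}`, with
`‖f‖_{X ^ p} = ‖ |f| ^ (1 / p) ‖_X ^ p`. -/
def FunctionSpace.concavification {𝕜 : Type*} [RCLike 𝕜] {Ω : Type*} [MeasurableSpace Ω]
    {μ : Measure Ω} (X : FunctionSpace 𝕜 μ) (p : ℝ) : FunctionSpace 𝕜 μ where
  carrier := {f | absPow (1 / p) f ∈ X.carrier}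
  qnorm f := X.qnorm (absPow (1 / p) f) ^ p

/-- A (nondegenerate) cube in `ℝ ^ d` with sides parallel to the coordinate axes, given by its
lower corner and its side length. -/
structure Cube (d : ℕ) where
  corner : Fin d → ℝ
  side : ℝ
  side_pos : 0 < side

/-- The points of a cube. Half-open cubes are used; changing the boundary of the cubes changes
neither averages nor (up to null sets) the sets in a sparse collection. -/
def Cube.toSet {d : ℕ} (Q : Cube d) : Set (Fin d → ℝ) :=
  Set.univ.pi fun i => Set.Ico (Q.corner i) (Q.corner i + Q.side)

/-- `S` is `η`-sparse: there are pairwise disjoint measurable `E_Q ⊆ Q`, `Q ∈ S`, with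
`|E_Q| ≥ η |Q|`. -/
def IsEtaSparse {d : ℕ} (η : ℝ≥0∞) (S : Set (Cube d)) : Prop :=
  ∃ E : Cube d → Set (Fin d → ℝ),
    (∀ Q ∈ S, MeasurableSet (E Q) ∧ E Q ⊆ Q.toSet ∧ η * volume Q.toSet ≤ volume (E Q)) ∧
    S.PairwiseDisjoint E

/-- `S` is sparse if it is `1/2`-sparse. -/
def IsSparse {d : ℕ} (S : Set (Cube d)) : Prop :=
  IsEtaSparse (1 / 2) S

/-- The averaging operator `A_S f = ∑_{Q ∈ S} ⟨|f|⟩_Q 1_Q`, with values in `[0, ∞]`. -/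
def avgOp {𝕜 : Type*} [RCLike 𝕜] {d : ℕ} (S : Set (Cube d)) (f : (Fin d → ℝ) → 𝕜)
    (x : Fin d → ℝ) : ℝ≥0∞ :=
  ∑' Q : S, Q.1.toSet.indicator
    (fun _ => (volume Q.1.toSet)⁻¹ * ∫⁻ y in Q.1.toSet, ‖f y‖ₑ) x

namespace FunctionSpace

/-- For every sparse `S` and every `f ∈ X`, the function `A_S f` is finite a.e. and belongs to `X`,
and `‖A_S f‖_X ≤ C ‖f‖_X`. -/
def SparseBound {𝕜 : Type*} [RCLike 𝕜] {d : ℕ}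
    (X : FunctionSpace 𝕜 (volume : Measure (Fin d → ℝ))) (C : ℝ) : Prop :=
  ∀ S : Set (Cube d), IsSparse S → ∀ f ∈ X.carrier, ∃ g ∈ X.carrier,
    (∀ᵐ x, avgOp S f x ≠ ∞ ∧ g x = ((avgOp S f x).toReal : 𝕜)) ∧ X.qnorm g ≤ C * X.qnorm f

/-- The sparse Muckenhoupt condition `X ∈ A_sparse`. -/
def MemASparse {𝕜 : Type*} [RCLike 𝕜] {d : ℕ}
    (X : FunctionSpace 𝕜 (volume : Measure (Fin d → ℝ))) : Prop :=
  ∃ C : ℝ, 0 < C ∧ X.SparseBound C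

/-- The smallest constant `[X]_{A_sparse}` in the sparse Muckenhoupt condition. -/
def aSparseConst {𝕜 : Type*} [RCLike 𝕜] {d : ℕ}
    (X : FunctionSpace 𝕜 (volume : Measure (Fin d → ℝ))) : ℝ :=
  sInf {C : ℝ | 0 < C ∧ X.SparseBound C}

end FunctionSpace

end

/-! The proof is extrapolation in the style of Rubio de Francia combined with the reverse Hölder
inequality for `A₁` weights.

A Calderón–Zygmund stopping argument bounds the maximal function of a grid pointwise by `2 * 3 ^ d`
times one sparse operator. A sparse bound on `X` therefore bounds the maximal functions of finitely
many shifted triadic grids, which together control averages over all cubes. Summing suitably damped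
iterates of this maximal function gives, for `F = |f| ^ (1 / r)`, a majorant `G` of norm at most `2
* K ^ 2 * ‖F‖` which is an `A₁` weight (`SparseBound.exists_A1_majorant`). Its `A₁` constant `A`
depends on `X` and not on `f` or `r`.

For `r - 1` small in terms of `A` and `d`, `Cube.avg_rpow_le_of_A1` gives `⟨|f|⟩_Q ≤ ⟨G ^ r⟩_Q ≤ 2 *
⟨G⟩_Q ^ r`, where the factor 2 is absolute. Since `ℓ¹ ⊆ ℓ^r`, summation over the sparse family
yields `A_S f ≤ 2 * (A_S G) ^ r`. Taking the power `1 / r` and applying the sparse bound of `X` to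
`G` gives the factor `4 * K ^ 2 * C`. The possibly large `A` enters only through the choice of `r₀`,
which is why the final estimate is linear in the sparse constant. -/

namespace Cube

/-! ### Cubes and averages. -/

variable {d : ℕ}

theorem measurableSet_toSet (Q : Cube d) : MeasurableSet Q.toSet :=
  MeasurableSet.univ_pi fun _ => measurableSet_Ico

theorem volume_toSet (Q : Cube d) : volume Q.toSet = ENNReal.ofReal Q.side ^ d := by
  simp [toSet, Real.volume_pi_Ico]

theorem volume_toSet_ne_zero (Q : Cube d) : volume Q.toSet ≠ 0 := by
  rw [volume_toSet]
  exact pow_ne_zero _ (ENNReal.ofReal_pos.2 Q.side_pos).ne'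

theorem volume_toSet_ne_top (Q : Cube d) : volume Q.toSet ≠ ∞ := by
  rw [volume_toSet]
  exact ENNReal.pow_ne_top ENNReal.ofReal_ne_top

theorem mem_toSet {Q : Cube d} {x : Fin d → ℝ} :
    x ∈ Q.toSet ↔ ∀ i, Q.corner i ≤ x i ∧ x i < Q.corner i + Q.side := by
  simp [toSet, Set.mem_pi]

/-- The average of a `[0, ∞]`-valued function over a cube. -/
noncomputable def avg (Q : Cube d) (f : (Fin d → ℝ) → ℝ≥0∞) : ℝ≥0∞ :=
  (volume Q.toSet)⁻¹ * ∫⁻ y in Q.toSet, f y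

theorem avg_mul_volume (Q : Cube d) (f : (Fin d → ℝ) → ℝ≥0∞) :
    Q.avg f * volume Q.toSet = ∫⁻ y in Q.toSet, f y := by
  rw [avg, mul_comm, ← mul_assoc,
    ENNReal.mul_inv_cancel Q.volume_toSet_ne_zero Q.volume_toSet_ne_top, one_mul]

theorem avg_mono (Q : Cube d) {f g : (Fin d → ℝ) → ℝ≥0∞} (h : ∀ᵐ x, f x ≤ g x) :
    Q.avg f ≤ Q.avg g :=
  mul_le_mul_right (lintegral_mono_ae (ae_restrict_of_ae h)) _

theorem lintegral_ne_top_of_avg {Q : Cube d} {f : (Fin d → ℝ) → ℝ≥0∞} (h : Q.avg f ≠ ∞) :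
    ∫⁻ y in Q.toSet, f y ≠ ∞ := by
  rw [← avg_mul_volume]
  exact ENNReal.mul_ne_top h Q.volume_toSet_ne_top

theorem avg_le_of_subset {Q R : Cube d} (h : Q.toSet ⊆ R.toSet) {c : ℝ} (hc : 0 ≤ c)
    (hs : R.side ≤ c * Q.side) (f : (Fin d → ℝ) → ℝ≥0∞) :
    Q.avg f ≤ ENNReal.ofReal c ^ d * R.avg f := by
  have h1 : volume R.toSet ≤ ENNReal.ofReal c ^ d * volume Q.toSet := by
    rw [volume_toSet, volume_toSet, ← mul_pow, ← ENNReal.ofReal_mul hc]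
    gcongr
  have h2 : ∫⁻ y in Q.toSet, f y ≤ R.avg f * volume R.toSet := by
    rw [avg_mul_volume]
    exact lintegral_mono_set h
  calc Q.avg f ≤ (volume Q.toSet)⁻¹ * (R.avg f * (ENNReal.ofReal c ^ d * volume Q.toSet)) := by
        unfold avg at h2 ⊢
        gcongr
        exact h2.trans (by gcongr)
    _ = (volume Q.toSet)⁻¹ * volume Q.toSet * (ENNReal.ofReal c ^ d * R.avg f) := by ring
    _ = _ := by
        rw [ENNReal.inv_mul_cancel Q.volume_toSet_ne_zero Q.volume_toSet_ne_top, one_mul]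

end Cube

/-! ### Shifted triadic grids and their nestedness. -/

/-- A grid of cubes with side lengths `scale * 3 ^ k`, whose vertices are shifted by a half-integer
multiple of the side length. -/
structure TriadicGrid (d : ℕ) where
  origin : Fin d → ℝ
  scale : ℝ
  scale_pos : 0 < scale
  shift : Fin d → ℝ
  two_mul_shift : ∀ i, ∃ n : ℤ, 2 * shift i = n

namespace TriadicGrid

variable {d : ℕ} (L : TriadicGrid d)

/-- The cube of generation `p.1` and position `p.2`. -/
noncomputable def cube (p : ℤ × (Fin d → ℤ)) : Cube d where
  corner i := L.origin i + L.scale * 3 ^ p.1 * (p.2 i + L.shift i)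
  side := L.scale * 3 ^ p.1
  side_pos := mul_pos L.scale_pos (by positivity)

/-- The position of the cube of generation `k` that contains `x`. -/
noncomputable def idx (k : ℤ) (x : Fin d → ℝ) : Fin d → ℤ :=
  fun i => ⌊(x i - L.origin i) / (L.scale * 3 ^ k) - L.shift i⌋

/-- The cube of generation `k` that contains `x`. -/
noncomputable def cell (k : ℤ) (x : Fin d → ℝ) : Cube d :=
  L.cube (k, L.idx k x)

theorem mem_cube {p : ℤ × (Fin d → ℤ)} {x : Fin d → ℝ} :
    x ∈ (L.cube p).toSet ↔ L.idx p.1 x = p.2 := by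
  have hs : 0 < L.scale * (3 : ℝ) ^ p.1 := (L.cube p).side_pos
  rw [Cube.mem_toSet, funext_iff]
  refine forall_congr' fun i => ?_
  simp only [idx, cube, Int.floor_eq_iff, le_sub_iff_add_le, sub_lt_iff_lt_add, le_div_iff₀ hs,
    div_lt_iff₀ hs]
  constructor <;> rintro ⟨h1, h2⟩ <;> constructor <;> nlinarith

theorem mem_cell (k : ℤ) (x : Fin d → ℝ) : x ∈ (L.cell k x).toSet :=
  L.mem_cube.2 rfl

theorem cell_eq_of_mem {p : ℤ × (Fin d → ℤ)} {x : Fin d → ℝ} (h : x ∈ (L.cube p).toSet) :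
    L.cell p.1 x = L.cube p := by
  rw [cell, L.mem_cube.1 h]

/-- Tripling a half-integer shift changes it by the integer `n`, twice the shift, so a parent's
position is determined by its child's. This is why the ratio is 3: with ratio 2, a shift by half a
side would destroy nestedness. -/
theorem idx_succ (k : ℤ) (x : Fin d → ℝ) (i : Fin d) {n : ℤ} (hn : 2 * L.shift i = n) :
    L.idx (k + 1) x i = (L.idx k x i - n) / 3 := by
  set t := (x i - L.origin i) / (L.scale * 3 ^ (k + 1)) with ht
  have h1 : (x i - L.origin i) / (L.scale * 3 ^ k) = 3 * t := by
    have := L.scale_pos.ne'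
    rw [ht, zpow_add₀ (by norm_num)]
    field_simp
  have h2 : L.idx k x i - n = ⌊3 * (t - L.shift i)⌋ := by
    simp only [idx, h1]
    rw [← Int.floor_sub_intCast, ← hn]
    congr 1
    ring
  rw [h2]
  have h3 := Int.floor_div_natCast (3 * (t - L.shift i)) 3
  have h4 : 3 * (t - L.shift i) / ((3 : ℕ) : ℝ) = t - L.shift i := by
    push_cast
    field_simp
  rw [h4] at h3
  simpa [idx, ht] using h3

theorem idx_eq_of_le {j k : ℤ} (hjk : j ≤ k) {x y : Fin d → ℝ} (h : L.idx j x = L.idx j y) :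
    L.idx k x = L.idx k y := by
  induction k, hjk using Int.leInduction with
  | base => exact h
  | succ k _ ih =>
    funext i
    obtain ⟨n, hn⟩ := L.two_mul_shift i
    rw [L.idx_succ k x i hn, L.idx_succ k y i hn, ih]

theorem cube_subset_cell {p : ℤ × (Fin d → ℤ)} {k : ℤ} (hk : p.1 ≤ k) {x : Fin d → ℝ}
    (hx : x ∈ (L.cube p).toSet) : (L.cube p).toSet ⊆ (L.cell k x).toSet := fun _ hy =>
  L.mem_cube.2 (L.idx_eq_of_le hk ((L.mem_cube.1 hy).trans (L.mem_cube.1 hx).symm))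

theorem volume_cell_succ (k : ℤ) (x : Fin d → ℝ) :
    volume (L.cell (k + 1) x).toSet = 3 ^ d * volume (L.cell k x).toSet := by
  rw [Cube.volume_toSet, Cube.volume_toSet]
  have : (L.cell (k + 1) x).side = 3 * (L.cell k x).side := by
    simp only [cell, cube, zpow_add₀ (three_ne_zero (α := ℝ)), zpow_one]
    ring
  rw [this, ENNReal.ofReal_mul (by norm_num), mul_pow]
  norm_num

theorem cell_injective_left (x : Fin d → ℝ) : Function.Injective fun k => L.cell k x := by
  intro j k h
  have h1 : L.scale * (3 : ℝ) ^ j = L.scale * 3 ^ k := congrArg Cube.side h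
  exact zpow_right_injective₀ (by norm_num) (by norm_num) (mul_left_cancel₀ L.scale_pos.ne' h1)

theorem measurable_avg_cell (k : ℤ) (f : (Fin d → ℝ) → ℝ≥0∞) :
    Measurable fun x => (L.cell k x).avg f := by
  have h1 : Measurable (L.idx k) := by
    refine measurable_pi_iff.2 fun i => Int.measurable_floor.comp ?_
    fun_prop
  have h2 : Measurable fun m : Fin d → ℤ => (L.cube (k, m)).avg f := measurable_of_countable _
  exact h2.comp h1

/-! ### Stopping cubes and superlevel sets. -/

/-- The points that lie in some cube of the grid with average larger than `t`. -/
def superlevel (f : (Fin d → ℝ) → ℝ≥0∞) (t : ℝ≥0∞) : Set (Fin d → ℝ) :=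
  {x | ∃ k, t < (L.cell k x).avg f}

theorem superlevel_anti (f : (Fin d → ℝ) → ℝ≥0∞) : Antitone (L.superlevel f) :=
  fun _ _ h _ ⟨k, hk⟩ => ⟨k, h.trans_lt hk⟩

theorem measurableSet_superlevel (f : (Fin d → ℝ) → ℝ≥0∞) (t : ℝ≥0∞) :
    MeasurableSet (L.superlevel f t) := by
  have : L.superlevel f t = ⋃ k, {x | t < (L.cell k x).avg f} := by
    ext x
    simp [superlevel]
  rw [this]
  exact MeasurableSet.iUnion fun k => measurableSet_lt measurable_const (L.measurable_avg_cell k f)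

/-- `p` is (the index of) a maximal cube of the grid with average larger than `t`. -/
def IsStopping (f : (Fin d → ℝ) → ℝ≥0∞) (t : ℝ≥0∞) (p : ℤ × (Fin d → ℤ)) : Prop :=
  t < (L.cube p).avg f ∧ ∀ x ∈ (L.cube p).toSet, ∀ k, p.1 < k → (L.cell k x).avg f ≤ t

variable {L} {f : (Fin d → ℝ) → ℝ≥0∞} {t : ℝ≥0∞} {p q : ℤ × (Fin d → ℤ)}

theorem IsStopping.subset_superlevel (hp : L.IsStopping f t p) :
    (L.cube p).toSet ⊆ L.superlevel f t := fun x hx =>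
  ⟨p.1, by rw [L.cell_eq_of_mem hx]; exact hp.1⟩

/-- Maximal cubes shrink as the height grows: a cube strictly larger than the lower-height maximal
cube has average at most the lower height. -/
theorem IsStopping.fst_le {s : ℝ≥0∞} (hst : s ≤ t) (hp : L.IsStopping f s p)
    (hq : L.IsStopping f t q) {x : Fin d → ℝ} (hxp : x ∈ (L.cube p).toSet)
    (hxq : x ∈ (L.cube q).toSet) : q.1 ≤ p.1 := by
  by_contra! h
  have := hp.2 x hxp q.1 h
  rw [L.cell_eq_of_mem hxq] at this
  exact (hq.1.trans_le (this.trans hst)).false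

theorem IsStopping.eq_of_mem (hp : L.IsStopping f t p) (hq : L.IsStopping f t q)
    {x : Fin d → ℝ} (hxp : x ∈ (L.cube p).toSet) (hxq : x ∈ (L.cube q).toSet) : p = q := by
  have h := le_antisymm (IsStopping.fst_le le_rfl hq hp hxq hxp)
    (IsStopping.fst_le le_rfl hp hq hxp hxq)
  refine Prod.ext h ?_
  rw [← L.mem_cube.1 hxp, ← L.mem_cube.1 hxq, h]

theorem exists_isStopping {x : Fin d → ℝ} (hb : BddAbove {k | t < (L.cell k x).avg f})
    (hx : x ∈ L.superlevel f t) : ∃ p, L.IsStopping f t p ∧ x ∈ (L.cube p).toSet := by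
  obtain ⟨b, hb⟩ := hb
  obtain ⟨k, hk, hmax⟩ := Int.exists_greatest_of_bdd (P := fun k => t < (L.cell k x).avg f)
    ⟨b, fun z hz => hb hz⟩ hx
  refine ⟨(k, L.idx k x), ⟨hk, fun y hy j hj => ?_⟩, L.mem_cell k x⟩
  by_contra! h
  have : L.idx j y = L.idx j x := L.idx_eq_of_le (le_of_lt hj) (L.mem_cube.1 hy)
  rw [cell, this] at h
  exact (hmax j h).not_gt hj

/-- By maximality the parent has average at most `t`, and its volume is only `3 ^ d` times larger.
-/
theorem IsStopping.avg_le (hp : L.IsStopping f t p) : (L.cube p).avg f ≤ 3 ^ d * t := by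
  obtain ⟨x, hx⟩ : (L.cube p).toSet.Nonempty :=
    nonempty_of_measure_ne_zero (L.cube p).volume_toSet_ne_zero
  have h1 := hp.2 x hx (p.1 + 1) (lt_add_one _)
  have h2 := L.cube_subset_cell (by simp : p.1 ≤ p.1 + 1) hx
  have h3 : (L.cell (p.1 + 1) x).side ≤ 3 * (L.cube p).side := by
    simp only [cell, cube, zpow_add₀ (three_ne_zero (α := ℝ)), zpow_one]
    linarith
  calc _ ≤ _ := Cube.avg_le_of_subset h2 (by norm_num) h3 f
    _ ≤ 3 ^ d * t := by
      norm_num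
      gcongr

theorem pairwiseDisjoint_stopping :
    {p | L.IsStopping f t p}.PairwiseDisjoint fun p => (L.cube p).toSet := fun _ hp _ hq h =>
  Set.disjoint_left.2 fun _ hxp hxq => h (IsStopping.eq_of_mem hp hq hxp hxq)

theorem superlevel_eq_biUnion (hb : ∀ x, BddAbove {k | t < (L.cell k x).avg f}) :
    L.superlevel f t = ⋃ p ∈ {p | L.IsStopping f t p}, (L.cube p).toSet := by
  ext x
  simp only [Set.mem_iUnion, Set.mem_ofPred_eq, exists_prop]
  exact ⟨fun h => exists_isStopping (hb x) h, fun ⟨p, hp, hx⟩ => hp.subset_superlevel hx⟩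

/-- A localized weak-type (1,1) bound: inside a maximal cube, the superlevel set at a greater height
is covered by disjoint stopping cubes contained in it, on each of which the average exceeds that
height. -/
theorem IsStopping.mul_volume_inter_le {s : ℝ≥0∞} (hst : s ≤ t)
    (hb : ∀ x, BddAbove {k | t < (L.cell k x).avg f}) (hp : L.IsStopping f s p) :
    t * volume ((L.cube p).toSet ∩ L.superlevel f t) ≤ ∫⁻ y in (L.cube p).toSet, f y := by
  set I := {q | L.IsStopping f t q ∧ (L.cube q).toSet ⊆ (L.cube p).toSet} with hI
  have hIc : I.Countable := Set.to_countable _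
  have hId : I.PairwiseDisjoint fun p => (L.cube p).toSet :=
    pairwiseDisjoint_stopping.subset fun q hq => hq.1
  have hsub : (L.cube p).toSet ∩ L.superlevel f t ⊆ ⋃ q ∈ I, (L.cube q).toSet := by
    rintro x ⟨hxp, hx⟩
    obtain ⟨q, hq, hxq⟩ := exists_isStopping (hb x) hx
    refine Set.mem_biUnion ⟨hq, ?_⟩ hxq
    rw [← L.cell_eq_of_mem hxp]
    exact L.cube_subset_cell (hp.fst_le hst hq hxp hxq) hxq
  calc t * volume ((L.cube p).toSet ∩ L.superlevel f t)
      ≤ t * ∑' q : I, volume (L.cube q).toSet := by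
        gcongr
        exact (measure_mono hsub).trans (measure_biUnion_le _ hIc _)
    _ = ∑' q : I, t * volume (L.cube q).toSet := ENNReal.tsum_mul_left.symm
    _ ≤ ∑' q : I, ∫⁻ y in (L.cube q).toSet, f y := by
        refine ENNReal.tsum_le_tsum fun q => ?_
        rw [← Cube.avg_mul_volume]
        gcongr
        exact q.2.1.1.le
    _ = ∫⁻ y in ⋃ q ∈ I, (L.cube q).toSet, f y :=
        (lintegral_biUnion hIc (fun q _ => (L.cube q).measurableSet_toSet) hId _).symm
    _ ≤ _ := lintegral_mono_set (Set.iUnion₂_subset fun q hq => hq.2)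

/-- At least half of a maximal cube at height `t` is outside the superlevel set at height
`2 * 3 ^ d * t`. -/
theorem IsStopping.half_volume_le (h0 : t ≠ 0) (htop : t ≠ ∞)
    (hb : ∀ x, BddAbove {k | 2 * 3 ^ d * t < (L.cell k x).avg f}) (hp : L.IsStopping f t p) :
    1 / 2 * volume (L.cube p).toSet ≤
      volume ((L.cube p).toSet \ L.superlevel f (2 * 3 ^ d * t)) := by
  have hv := (L.cube p).volume_toSet_ne_top
  have h3 : (3 : ℝ≥0∞) ^ d ≠ ∞ := ENNReal.pow_ne_top (by norm_num)
  have h3t0 : 3 ^ d * t ≠ 0 := mul_ne_zero (pow_ne_zero _ (by norm_num)) h0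
  have h3tt : 3 ^ d * t ≠ ∞ := ENNReal.mul_ne_top h3 htop
  have hst : t ≤ 2 * 3 ^ d * t := by
    have : (1 : ℝ≥0∞) ≤ 2 * 3 ^ d := by
      calc (1 : ℝ≥0∞) = 1 * 1 := by simp
        _ ≤ 2 * 3 ^ d := by
          gcongr
          · norm_num
          · exact one_le_pow₀ (by norm_num)
    simpa using mul_le_mul_left this t
  have h1 := hp.mul_volume_inter_le hst hb
  set U := (L.cube p).toSet ∩ L.superlevel f (2 * 3 ^ d * t)
  rw [← Cube.avg_mul_volume] at h1
  have h2 : 3 ^ d * t * (2 * volume U) ≤ 3 ^ d * t * volume (L.cube p).toSet := by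
    calc _ = 2 * 3 ^ d * t * volume U := by ring
      _ ≤ _ := h1
      _ ≤ _ := by gcongr; exact hp.avg_le
  have h4 : 2 * volume U ≤ volume (L.cube p).toSet :=
    (ENNReal.mul_le_mul_iff_right h3t0 h3tt).1 h2
  have h5 : volume U + volume ((L.cube p).toSet \ L.superlevel f (2 * 3 ^ d * t))
      = volume (L.cube p).toSet := measure_inter_add_sdiff _ (L.measurableSet_superlevel f _)
  set W := volume ((L.cube p).toSet \ L.superlevel f (2 * 3 ^ d * t))
  have hU : volume U ≠ ∞ := ne_top_of_le_ne_top hv (measure_mono Set.inter_subset_left)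
  have h6 : volume U ≤ W := by
    rw [← h5, two_mul] at h4
    exact (ENNReal.add_le_add_iff_left hU).1 h4
  calc 1 / 2 * volume (L.cube p).toSet ≤ 1 / 2 * (W + W) := by
        rw [← h5]
        gcongr
    _ = W := by
      rw [← two_mul, ← mul_assoc, one_div, ENNReal.inv_mul_cancel (by norm_num) (by norm_num),
        one_mul]

/-! ### Covering arbitrary cubes by cubes of the shifted grids. -/

/-- The grid of scale `1` with origin `0`, shifted by half a side length in the directions
selected by `b`. -/
noncomputable def standard (b : Fin d → Bool) : TriadicGrid d where
  origin := 0
  scale := 1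
  scale_pos := one_pos
  shift i := if b i then 1 / 2 else 0
  two_mul_shift i := ⟨if b i then 1 else 0, by split <;> norm_num⟩

theorem exists_standard_cube_superset (Q : Cube d) : ∃ (b : Fin d → Bool) (p : ℤ × (Fin d → ℤ)),
    Q.toSet ⊆ ((standard b).cube p).toSet ∧ ((standard b).cube p).side ≤ 6 * Q.side := by
  -- The side `s = 3 ^ (k + 1)` is at least twice that of `Q`, so one of two shifts works in each
  -- coordinate, and less than six times that of `Q`.
  obtain ⟨k, hk1, hk2⟩ := exists_mem_Ioc_zpow (x := 2 * Q.side) (y := (3 : ℝ))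
    (by linarith [Q.side_pos]) (by norm_num)
  have hs : (0 : ℝ) < 3 ^ (k + 1) := by positivity
  set s : ℝ := 3 ^ (k + 1) with hsdef
  have hs3 : s = 3 * 3 ^ k := by
    rw [hsdef, zpow_add₀ (by norm_num)]
    ring
  have key : ∀ i, ∃ (b : Bool) (m : ℤ), s * (m + if b then 1 / 2 else 0) ≤ Q.corner i ∧
      Q.corner i + Q.side ≤ s * (m + if b then 1 / 2 else 0) + s := by
    intro i
    set t := Q.corner i / s
    have ht : Q.corner i = s * t := by simp only [t]; field_simp
    have h1 := Int.floor_le t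
    have h2 := Int.lt_floor_add_one t
    -- An interval of length at most `s / 2` that starts in the left half of a cell stays in that
    -- cell; otherwise it lies in the cell shifted by `s / 2`.
    rcases le_or_gt (t - ⌊t⌋) (1 / 2) with h | h
    · refine ⟨false, ⌊t⌋, ?_, ?_⟩
      · simp only [Bool.false_eq_true, if_false, ht]
        nlinarith
      · simp only [Bool.false_eq_true, if_false, ht]
        nlinarith
    · refine ⟨true, ⌊t⌋, ?_, ?_⟩
      · simp only [if_true, ht]
        nlinarith
      · simp only [if_true, ht]
        nlinarith
  choose b m hbm using key
  refine ⟨b, (k + 1, m), fun x hx => ?_, ?_⟩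
  · rw [Cube.mem_toSet] at hx ⊢
    intro i
    have h1 := hbm i
    have h2 := hx i
    simp only [cube, standard, Pi.zero_apply, one_mul, zero_add, ← hsdef]
    exact ⟨h1.1.trans h2.1, h2.2.trans_le h1.2⟩
  · simp only [cube, standard, one_mul, ← hsdef]
    linarith

end TriadicGrid

/-! ### Lebesgue differentiation, with cubes viewed as balls of the sup norm. -/

theorem Cube.toSet_ae_eq_closedBall {d : ℕ} (Q : Cube d) :
    Q.toSet =ᵐ[volume] Metric.closedBall (fun i => Q.corner i + Q.side / 2) (Q.side / 2) := by
  have h : Metric.closedBall (fun i => Q.corner i + Q.side / 2) (Q.side / 2) =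
      Set.Icc Q.corner fun i => Q.corner i + Q.side := by
    rw [closedBall_pi _ (by linarith [Q.side_pos]), ← Set.pi_univ_Icc]
    congr 1
    funext i
    rw [Real.closedBall_eq_Icc]
    congr 1 <;> ring
  rw [h]
  exact Measure.univ_pi_Ico_ae_eq_Icc

namespace TriadicGrid

variable {d : ℕ} (L : TriadicGrid d)

/-- Lebesgue differentiation along the cubes of a grid. -/
theorem ae_tendsto_avg_cell {f : (Fin d → ℝ) → ℝ≥0∞} (hf : Measurable f)
    (hfi : ∫⁻ y, f y ≠ ∞) :
    ∀ᵐ x, Tendsto (fun n : ℕ => (L.cell (-n) x).avg f) atTop (𝓝 (f x)) := by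
  filter_upwards [(IsUnifLocDoublingMeasure.vitaliFamily (volume : Measure (Fin d → ℝ))
    1).ae_tendsto_lintegral_div hf.aemeasurable hfi] with x hx
  set c : ℕ → Fin d → ℝ := fun n i => (L.cell (-n) x).corner i + (L.cell (-n) x).side / 2
  set δ : ℕ → ℝ := fun n => (L.cell (-n) x).side / 2
  have hδ : Tendsto δ atTop (𝓝[>] 0) := by
    rw [tendsto_nhdsWithin_iff]
    constructor
    · have h1 : δ = fun n : ℕ => L.scale / 2 * (1 / 3) ^ n := by
        funext n
        simp only [δ, cell, cube, zpow_neg, zpow_natCast, one_div, inv_pow]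
        ring
      rw [h1]
      simpa using (tendsto_pow_atTop_nhds_zero_of_lt_one (r := (1 / 3 : ℝ)) (by norm_num)
        (by norm_num)).const_mul (L.scale / 2)
    · exact Eventually.of_forall fun n => half_pos (L.cell (-n) x).side_pos
  have hmem : ∀ᶠ n in atTop, x ∈ Metric.closedBall (c n) (1 * δ n) := by
    refine Eventually.of_forall fun n => ?_
    rw [one_mul, closedBall_pi _ (half_pos (L.cell (-n) x).side_pos).le]
    intro i _
    beta_reduce
    rw [Real.closedBall_eq_Icc]
    have := Cube.mem_toSet.1 (L.mem_cell (-n) x) i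
    simp only [c]
    constructor <;> linarith
  have h2 := hx.comp (IsUnifLocDoublingMeasure.tendsto_closedBall_filterAt volume c δ hδ hmem)
  refine h2.congr fun n => ?_
  have h3 := (L.cell (-n) x).toSet_ae_eq_closedBall
  simp only [Function.comp_apply, Cube.avg, c, δ]
  rw [← measure_congr h3, ← setLIntegral_congr h3, ENNReal.div_eq_inv_mul]

theorem ae_mem_superlevel {f : (Fin d → ℝ) → ℝ≥0∞} (hf : Measurable f)
    (hfi : ∫⁻ y, f y ≠ ∞) : ∀ᵐ x, ∀ t, t < f x → x ∈ L.superlevel f t := by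
  filter_upwards [L.ae_tendsto_avg_cell hf hfi] with x hx t ht
  obtain ⟨n, hn⟩ := (hx.eventually (lt_mem_nhds ht)).exists
  exact ⟨_, hn⟩

end TriadicGrid

/-! ### Reverse Hölder inequality for `A₁` weights. -/

namespace Cube

variable {d : ℕ} (Q : Cube d)

/-- The grid of triadic subcubes (and ancestors) of a cube. -/
noncomputable def grid : TriadicGrid d where
  origin := Q.corner
  scale := Q.side
  scale_pos := Q.side_pos
  shift := 0
  two_mul_shift _ := ⟨0, by simp⟩

theorem grid_cube_zero : Q.grid.cube (0, 0) = Q := by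
  simp [grid, TriadicGrid.cube]

theorem grid_cell_zero {x : Fin d → ℝ} (hx : x ∈ Q.toSet) : Q.grid.cell 0 x = Q := by
  conv_rhs => rw [← Q.grid_cube_zero]
  exact Q.grid.cell_eq_of_mem (p := (0, 0)) (by rwa [Q.grid_cube_zero])

variable {Q} {w : (Fin d → ℝ) → ℝ≥0∞} {t : ℝ≥0∞}

/-- Cells of generation at least 0 are no smaller than `Q`, while the truncated weight has no mass
outside `Q`. Hence stopping above the height `Q.avg w` takes place inside `Q`. -/
theorem avg_grid_cell_le {k : ℤ} (hk : 0 ≤ k) (x : Fin d → ℝ) :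
    (Q.grid.cell k x).avg (Q.toSet.indicator w) ≤ Q.avg w := by
  have h1 : Q.side ≤ (Q.grid.cell k x).side := by
    have : (1 : ℝ) ≤ 3 ^ k := one_le_zpow₀ (by norm_num) hk
    simp only [TriadicGrid.cell, TriadicGrid.cube, grid]
    nlinarith [Q.side_pos]
  have h2 : volume Q.toSet ≤ volume (Q.grid.cell k x).toSet := by
    rw [volume_toSet, volume_toSet]
    gcongr
  unfold avg
  refine mul_le_mul' (ENNReal.inv_le_inv.2 h2) ?_
  calc _ ≤ ∫⁻ y, Q.toSet.indicator w y := setLIntegral_le_lintegral _ _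
    _ = _ := lintegral_indicator Q.measurableSet_toSet _

theorem bddAbove_grid (ht : Q.avg w ≤ t) (x : Fin d → ℝ) :
    BddAbove {k | t < (Q.grid.cell k x).avg (Q.toSet.indicator w)} := by
  refine ⟨0, fun k hk => ?_⟩
  by_contra! h
  exact (hk.trans_le ((avg_grid_cell_le h.le x).trans ht)).false

theorem cube_subset_of_isStopping (ht : Q.avg w ≤ t) {p : ℤ × (Fin d → ℤ)}
    (hp : Q.grid.IsStopping (Q.toSet.indicator w) t p) : (Q.grid.cube p).toSet ⊆ Q.toSet := by
  obtain ⟨y, hyp, hyQ⟩ : ((Q.grid.cube p).toSet ∩ Q.toSet).Nonempty := by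
    by_contra! h
    have h1 : (Q.grid.cube p).avg (Q.toSet.indicator w) = 0 := by
      have : ∫⁻ y in (Q.grid.cube p).toSet, Q.toSet.indicator w y = 0 := by
        rw [setLIntegral_congr_fun (g := fun _ => 0) (Q.grid.cube p).measurableSet_toSet]
        · simp
        · intro y hy
          exact Set.indicator_of_notMem (fun hyQ => (h ▸ ⟨hy, hyQ⟩ : y ∈ (∅ : Set _))) _
      rw [avg, this, mul_zero]
    exact not_lt_zero (h1 ▸ hp.1)
  have hp0 : p.1 ≤ 0 := by
    by_contra! h
    have := hp.1
    rw [← Q.grid.cell_eq_of_mem hyp] at this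
    exact (this.trans_le ((avg_grid_cell_le h.le y).trans ht)).false
  have := Q.grid.cube_subset_cell hp0 hyp
  rwa [Q.grid_cell_zero hyQ] at this

/-- At least half of each stopping cube `P` avoids the next superlevel set, and `A₁` gives `w ≥
P.avg w / A` on that half. So it carries at least the fraction `1 / (2 * A)` of the mass of `P`. -/
theorem lintegral_superlevel_le {A : ℝ≥0∞}
    (hA1 : ∀ (R : Cube d), ∀ x ∈ R.toSet, R.avg w ≤ A * w x) (hw : Measurable w)
    (h0 : t ≠ 0) (htop : t ≠ ∞) (ht : Q.avg w ≤ t) :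
    ∫⁻ y in Q.grid.superlevel (Q.toSet.indicator w) t, Q.toSet.indicator w y ≤
      2 * A * ∫⁻ y in Q.grid.superlevel (Q.toSet.indicator w) t \
        Q.grid.superlevel (Q.toSet.indicator w) (2 * 3 ^ d * t), Q.toSet.indicator w y := by
  set f := Q.toSet.indicator w with hf
  have hst : t ≤ 2 * 3 ^ d * t := by
    have : (1 : ℝ≥0∞) ≤ 2 * 3 ^ d := by exact_mod_cast Nat.pos_of_ne_zero (by positivity)
    simpa using mul_le_mul_left this t
  set Ω' := Q.grid.superlevel f (2 * 3 ^ d * t) with hΩ'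
  have hΩm : MeasurableSet Ω' := Q.grid.measurableSet_superlevel _ _
  rw [TriadicGrid.superlevel_eq_biUnion (bddAbove_grid ht)]
  set I := {p | Q.grid.IsStopping f t p}
  have hIc : I.Countable := Set.to_countable _
  have hId : I.PairwiseDisjoint fun p => (Q.grid.cube p).toSet :=
    TriadicGrid.pairwiseDisjoint_stopping
  rw [lintegral_biUnion hIc (fun q _ => (Q.grid.cube q).measurableSet_toSet) hId]
  have hdiff : (⋃ p ∈ I, (Q.grid.cube p).toSet) \ Ω' =
      ⋃ p ∈ I, (Q.grid.cube p).toSet \ Ω' := by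
    ext x
    simp only [Set.mem_sdiff, Set.mem_iUnion]
    tauto
  rw [hdiff, lintegral_biUnion hIc
    (fun q _ => (Q.grid.cube q).measurableSet_toSet.diff hΩm)
    (hId.mono_on fun q _ => Set.sdiff_subset), ← ENNReal.tsum_mul_left]
  refine ENNReal.tsum_le_tsum fun ⟨p, hp⟩ => ?_
  have hsub := cube_subset_of_isStopping ht hp
  have hhalf := hp.half_volume_le h0 htop (bddAbove_grid (ht.trans hst))
  set P := Q.grid.cube p
  have hfP : ∀ y ∈ P.toSet, f y = w y := fun y hy => Set.indicator_of_mem (hsub hy) _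
  have havg : P.avg f = P.avg w := by
    unfold avg
    rw [setLIntegral_congr_fun P.measurableSet_toSet hfP]
  have hfm : Measurable f := hw.indicator Q.measurableSet_toSet
  calc ∫⁻ y in P.toSet, f y = 2 * P.avg w * (1 / 2 * volume P.toSet) := by
        rw [← avg_mul_volume, havg]
        calc _ = (2 * (1 / 2)) * (P.avg w * volume P.toSet) := by
              rw [one_div, ENNReal.mul_inv_cancel (by norm_num) (by norm_num), one_mul]
          _ = _ := by ring
    _ ≤ 2 * P.avg w * volume (P.toSet \ Ω') := by gcongr
    _ = 2 * ∫⁻ _ in P.toSet \ Ω', P.avg w := by rw [setLIntegral_const]; ring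
    _ ≤ 2 * ∫⁻ y in P.toSet \ Ω', A * f y := by
        refine mul_le_mul_right (setLIntegral_mono (hfm.const_mul A) fun y hy => ?_) _
        rw [hfP y hy.1]
        exact hA1 P y hy.1
    _ = 2 * A * ∫⁻ y in P.toSet \ Ω', f y := by rw [lintegral_const_mul _ hfm]; ring

/-- Subtracting the fraction `1 / (2 * A)` lost between consecutive heights turns the previous bound
into geometric decay. The subtraction needs finite mass, hence `hQ`. -/
theorem lintegral_superlevel_succ_le {A : ℝ} (hA : 1 ≤ A)
    (hA1 : ∀ (R : Cube d), ∀ x ∈ R.toSet, R.avg w ≤ ENNReal.ofReal A * w x) (hw : Measurable w)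
    (hQ : Q.avg w ≠ ∞) (h0 : t ≠ 0) (htop : t ≠ ∞) (ht : Q.avg w ≤ t) :
    ∫⁻ y in Q.grid.superlevel (Q.toSet.indicator w) (2 * 3 ^ d * t), Q.toSet.indicator w y ≤
      ENNReal.ofReal (1 - 1 / (2 * A)) *
        ∫⁻ y in Q.grid.superlevel (Q.toSet.indicator w) t, Q.toSet.indicator w y := by
  have hst : t ≤ 2 * 3 ^ d * t := by
    have : (1 : ℝ≥0∞) ≤ 2 * 3 ^ d := by exact_mod_cast Nat.pos_of_ne_zero (by positivity)
    simpa using mul_le_mul_left this t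
  have h1 := lintegral_superlevel_le hA1 hw h0 htop ht
  have hsub := Q.grid.superlevel_anti (Q.toSet.indicator w) hst
  have h2 := lintegral_inter_add_sdiff (μ := volume) (Q.toSet.indicator w)
    (Q.grid.superlevel (Q.toSet.indicator w) t)
    (Q.grid.measurableSet_superlevel (Q.toSet.indicator w) (2 * 3 ^ d * t))
  rw [Set.inter_eq_right.2 hsub] at h2
  have hfin : ∫⁻ y, Q.toSet.indicator w y ≠ ∞ := by
    rw [lintegral_indicator Q.measurableSet_toSet]
    exact lintegral_ne_top_of_avg hQ
  have hf : ∀ S, ∫⁻ y in S, Q.toSet.indicator w y ≠ ∞ := fun S =>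
    ne_top_of_le_ne_top hfin (setLIntegral_le_lintegral _ _)
  have g0 := hf (Q.grid.superlevel (Q.toSet.indicator w) t)
  have g1 := hf (Q.grid.superlevel (Q.toSet.indicator w) (2 * 3 ^ d * t))
  have g2 := hf (Q.grid.superlevel (Q.toSet.indicator w) t \
    Q.grid.superlevel (Q.toSet.indicator w) (2 * 3 ^ d * t))
  generalize (∫⁻ y in Q.grid.superlevel (Q.toSet.indicator w) t, Q.toSet.indicator w y) = a at *
  generalize (∫⁻ y in Q.grid.superlevel (Q.toSet.indicator w) (2 * 3 ^ d * t),
    Q.toSet.indicator w y) = b at *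
  generalize (∫⁻ y in Q.grid.superlevel (Q.toSet.indicator w) t \
    Q.grid.superlevel (Q.toSet.indicator w) (2 * 3 ^ d * t), Q.toSet.indicator w y) = c at *
  lift a to NNReal using g0
  lift b to NNReal using g1
  lift c to NNReal using g2
  have hθ : 0 ≤ 1 - 1 / (2 * A) := by
    have : 1 / (2 * A) ≤ 1 := by
      rw [div_le_one (by linarith)]
      linarith
    linarith
  rw [← ENNReal.toReal_le_toReal ENNReal.coe_ne_top (ENNReal.mul_ne_top ENNReal.ofReal_ne_top
    ENNReal.coe_ne_top), ENNReal.toReal_mul, ENNReal.toReal_ofReal hθ]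
  have h1' : (a : ℝ) ≤ 2 * A * c := by
    have := ENNReal.toReal_mono (ENNReal.mul_ne_top (ENNReal.mul_ne_top (by norm_num)
      ENNReal.ofReal_ne_top) ENNReal.coe_ne_top) h1
    simpa [ENNReal.toReal_ofReal (zero_le_one.trans hA)] using this
  have h2' : (b : ℝ) + c = a := by exact_mod_cast h2
  simp only [ENNReal.coe_toReal]
  have h3 : (a : ℝ) / (2 * A) ≤ c := by
    rw [div_le_iff₀ (by linarith)]
    linarith
  have h4 : (1 - 1 / (2 * A)) * (a : ℝ) = a - a / (2 * A) := by ring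
  rw [h4]
  linarith

theorem one_add_sum_geometric (b : ℝ≥0∞) (hb : 1 ≤ b) (n : ℕ) :
    1 + ∑ j ∈ Finset.range n, (b - 1) * b ^ j = b ^ n := by
  induction n with
  | zero => simp
  | succ n ih =>
    rw [Finset.sum_range_succ, ← add_assoc, ih]
    calc b ^ n + (b - 1) * b ^ n = (1 + (b - 1)) * b ^ n := by ring
      _ = b ^ (n + 1) := by rw [add_tsub_cancel_of_le hb, pow_succ']

/-- The reverse Hölder inequality for `A₁` weights. -/
theorem avg_rpow_le_of_A1 {A : ℝ} (hA : 1 ≤ A)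
    (hA1 : ∀ (R : Cube d), ∀ x ∈ R.toSet, R.avg w ≤ ENNReal.ofReal A * w x) (hw : Measurable w)
    (hQ : Q.avg w ≠ ∞) {δ : ℝ} (hδ0 : 0 < δ)
    (hδ : (2 * 3 ^ d : ℝ) ^ δ * (2 - 1 / (2 * A)) ≤ 2) :
    Q.avg (fun x => w x ^ (1 + δ)) ≤ 2 * Q.avg w ^ (1 + δ) := by
  set a : ℝ≥0∞ := 2 * 3 ^ d with ha
  set f := Q.toSet.indicator w with hf
  have ha1 : 1 < a := by
    have : (1 : ℝ≥0∞) ≤ 3 ^ d := one_le_pow₀ (by norm_num)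
    calc (1 : ℝ≥0∞) < 2 * 1 := by norm_num
      _ ≤ a := by rw [ha]; gcongr
  have hatop : a ≠ ∞ := ENNReal.mul_ne_top (by norm_num) (ENNReal.pow_ne_top (by norm_num))
  have hfin : ∫⁻ y, f y ≠ ∞ := by
    rw [lintegral_indicator Q.measurableSet_toSet]
    exact lintegral_ne_top_of_avg hQ
  have hfm : Measurable f := hw.indicator Q.measurableSet_toSet
  set l := Q.avg w with hl
  rcases eq_or_ne l 0 with h0 | h0
  · have h1 : ∫⁻ y in Q.toSet, w y = 0 := by
      rw [← avg_mul_volume, ← hl, h0, zero_mul]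
    have h2 : ∫⁻ y in Q.toSet, w y ^ (1 + δ) = 0 := by
      rw [lintegral_eq_zero_iff hw] at h1
      rw [lintegral_eq_zero_iff (hw.pow_const _)]
      filter_upwards [h1] with y hy
      rw [hy]
      simp only [Pi.zero_apply]
      exact ENNReal.zero_rpow_of_pos (by linarith)
    rw [avg, h2, mul_zero]
    exact zero_le
  set b : ℝ≥0∞ := a ^ δ with hb
  have hb1 : 1 ≤ b := ENNReal.one_le_rpow ha1.le hδ0
  set θ : ℝ≥0∞ := ENNReal.ofReal (1 - 1 / (2 * A)) with hθ
  have hθ0 : 0 ≤ 1 - 1 / (2 * A) := by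
    have : 1 / (2 * A) ≤ 1 := by
      rw [div_le_one (by linarith)]
      linarith
    linarith
  -- The smallness assumption on `δ` in the form needed to sum the geometric series: `b - 1 ≤ 1 - b
  -- * θ`.
  have hbθ : b * (1 + θ) ≤ 2 := by
    have h1 : a = ENNReal.ofReal (2 * 3 ^ d) := by
      rw [ENNReal.ofReal_mul (by norm_num), ENNReal.ofReal_pow (by norm_num)]
      norm_num [ha]
    have h2 : b = ENNReal.ofReal ((2 * 3 ^ d) ^ δ) := by
      rw [hb, h1, ENNReal.ofReal_rpow_of_pos (by positivity)]
    rw [h2, hθ, ← ENNReal.ofReal_one, ← ENNReal.ofReal_add zero_le_one hθ0,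
      ← ENNReal.ofReal_mul (by positivity)]
    calc _ ≤ ENNReal.ofReal 2 := ENNReal.ofReal_le_ofReal (by convert hδ using 2; ring)
      _ = 2 := by norm_num
  set Ω : ℕ → Set (Fin d → ℝ) := fun j => Q.grid.superlevel f (a ^ j * l) with hΩ
  have hlj : ∀ j : ℕ, l ≤ a ^ j * l := fun j => by
    simpa using mul_le_mul_left (one_le_pow₀ ha1.le : 1 ≤ a ^ j) l
  have hdecay : ∀ j, ∫⁻ y in Ω j, f y ≤ θ ^ j * ∫⁻ y in Q.toSet, w y := by
    intro j
    induction j with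
    | zero =>
      rw [pow_zero, one_mul, ← lintegral_indicator Q.measurableSet_toSet]
      exact setLIntegral_le_lintegral _ _
    | succ j ih =>
      have h1 := lintegral_superlevel_succ_le hA hA1 hw hQ (t := a ^ j * l)
        (mul_ne_zero (pow_ne_zero _ (zero_lt_one.trans ha1).ne') h0)
        (ENNReal.mul_ne_top (ENNReal.pow_ne_top hatop) hQ) (hlj j)
      have h2 : Ω (j + 1) = Q.grid.superlevel f (2 * 3 ^ d * (a ^ j * l)) := by
        simp only [hΩ]
        congr 1
        rw [pow_succ', ← ha, mul_assoc]
      rw [h2]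
      refine h1.trans ?_
      calc _ ≤ θ * (θ ^ j * ∫⁻ y in Q.toSet, w y) := mul_le_mul_right ih _
        _ = _ := by rw [pow_succ']; ring
  -- Layer decomposition: let `n` be least with `f x ≤ a ^ n * l`. Then `f x ^ δ ≤ l ^ δ * b ^ n`,
  -- the power `b ^ n` telescopes into `1 + ∑ (b - 1) * b ^ j` over `j < n`, and Lebesgue
  -- differentiation puts `x` in `Ω j` for each such `j`.
  have hpt : ∀ᵐ x, x ∈ Q.toSet → w x ^ (1 + δ) ≤
      l ^ δ * (f x + ∑' j, (b - 1) * b ^ j * (Ω j).indicator f x) := by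
    have hfw : ∀ᵐ x, f x < ∞ := ae_lt_top hfm hfin
    filter_upwards [Q.grid.ae_mem_superlevel hfm hfin, hfw] with x hx hxt hxQ
    have hfx : f x = w x := Set.indicator_of_mem hxQ _
    rw [← hfx]
    have hsplit : f x ^ (1 + δ) = f x ^ δ * f x := by
      rw [ENNReal.rpow_add_of_nonneg _ _ zero_le_one hδ0.le, ENNReal.rpow_one, mul_comm]
    rcases le_or_gt (f x) l with h | h
    · rw [hsplit]
      gcongr
      exact le_self_add
    · have hex : ∃ n : ℕ, f x ≤ a ^ n * l := by
        have h3 : Tendsto (fun n : ℕ => a ^ n * l) atTop (𝓝 (∞ * l)) := by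
          refine ENNReal.Tendsto.mul_const ?_ (Or.inl ENNReal.top_ne_zero)
          exact ENNReal.tendsto_pow_atTop_nhds_top_iff.2 ha1
        rw [ENNReal.top_mul h0] at h3
        exact ((h3.eventually (lt_mem_nhds hxt)).mono fun _ h => h.le).exists
      classical
      set n := Nat.find hex
      have hn : f x ≤ a ^ n * l := Nat.find_spec hex
      have hmem : ∀ j ∈ Finset.range n, x ∈ Ω j := fun j hj =>
        hx _ (not_le.1 (Nat.find_min hex (Finset.mem_range.1 hj)))
      have hsum : ∑ j ∈ Finset.range n, (b - 1) * b ^ j * f x ≤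
          ∑' j, (b - 1) * b ^ j * (Ω j).indicator f x := by
        refine le_trans (Finset.sum_le_sum fun j hj => ?_)
          (ENNReal.sum_le_tsum (Finset.range n))
        rw [Set.indicator_of_mem (hmem j hj)]
      have hpow : f x ^ δ ≤ l ^ δ * b ^ n := by
        calc f x ^ δ ≤ (a ^ n * l) ^ δ := by gcongr
          _ = l ^ δ * b ^ n := by
            rw [ENNReal.mul_rpow_of_nonneg _ _ hδ0.le, hb, ← ENNReal.rpow_natCast,
              ← ENNReal.rpow_natCast, ← ENNReal.rpow_mul, ← ENNReal.rpow_mul, mul_comm (n : ℝ),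
              mul_comm]
      rw [hsplit]
      calc f x ^ δ * f x ≤ l ^ δ * b ^ n * f x := by gcongr
        _ = l ^ δ * (f x + ∑ j ∈ Finset.range n, (b - 1) * b ^ j * f x) := by
          rw [← one_add_sum_geometric b hb1 n, ← Finset.sum_mul]
          ring
        _ ≤ _ := by gcongr
  have hint : ∫⁻ y in Q.toSet, w y ^ (1 + δ) ≤ l ^ δ * (2 * ∫⁻ y in Q.toSet, w y) := by
    set W := ∫⁻ y in Q.toSet, w y
    have hΩm : ∀ j, MeasurableSet (Ω j) := fun j => Q.grid.measurableSet_superlevel _ _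
    calc _ ≤ ∫⁻ y in Q.toSet, l ^ δ * (f y + ∑' j, (b - 1) * b ^ j * (Ω j).indicator f y) :=
          setLIntegral_mono_ae' Q.measurableSet_toSet hpt
      _ ≤ ∫⁻ y, l ^ δ * (f y + ∑' j, (b - 1) * b ^ j * (Ω j).indicator f y) :=
          setLIntegral_le_lintegral _ _
      _ = l ^ δ * (W + ∑' j, (b - 1) * b ^ j * ∫⁻ y in Ω j, f y) := by
          have hm : ∀ j, Measurable fun y => (b - 1) * b ^ j * (Ω j).indicator f y := fun j =>
            (hfm.indicator (hΩm j)).const_mul _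
          have hM : Measurable fun y => ∑' j, (b - 1) * b ^ j * (Ω j).indicator f y :=
            Measurable.tsum hm
          have hM' : Measurable fun y => f y + ∑' j, (b - 1) * b ^ j * (Ω j).indicator f y :=
            hfm.add hM
          rw [lintegral_const_mul _ hM',
            lintegral_add_left hfm, lintegral_tsum fun j => (hm j).aemeasurable,
            lintegral_indicator Q.measurableSet_toSet]
          congr 3
          funext j
          rw [lintegral_const_mul _ (hfm.indicator (hΩm j)), lintegral_indicator (hΩm j)]
      _ ≤ l ^ δ * (W + ∑' j, (b - 1) * b ^ j * (θ ^ j * W)) := by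
          gcongr with j
          exact hdecay j
      _ = l ^ δ * (W + (b - 1) * (1 - b * θ)⁻¹ * W) := by
          rw [← ENNReal.tsum_geometric, ← ENNReal.tsum_mul_left, ← ENNReal.tsum_mul_right]
          congr 3
          funext j
          rw [mul_pow]
          ring
      -- By `hbθ` the layers together contribute at most one more copy of `W`; this is the source of
      -- the absolute constant 2.
      _ ≤ l ^ δ * (W + 1 * W) := by
          have hle : b - 1 ≤ 1 - b * θ := by
            have h1 : b + b * θ ≤ 1 + 1 := by
              calc b + b * θ = b * (1 + θ) := by ring
                _ ≤ 1 + 1 := by rw [one_add_one_eq_two]; exact hbθ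
            have hbθ1 : b * θ ≤ 1 := by
              have h3 : 1 + b * θ ≤ 1 + 1 := le_trans (by gcongr) h1
              exact (ENNReal.add_le_add_iff_left ENNReal.one_ne_top).1 h3
            have hbθt : b * θ ≠ ∞ := ne_top_of_le_ne_top ENNReal.one_ne_top hbθ1
            refine ENNReal.le_sub_of_add_le_right hbθt ?_
            have : (b - 1) + b * θ + 1 ≤ 1 + 1 := by
              calc _ = (b - 1 + 1) + b * θ := by ring
                _ ≤ 1 + 1 := by rw [tsub_add_cancel_of_le hb1]; exact h1
            exact (ENNReal.add_le_add_iff_right ENNReal.one_ne_top).1 this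
          gcongr
          rw [← div_eq_mul_inv]
          exact ENNReal.div_le_of_le_mul (by rwa [one_mul])
      _ = _ := by ring
  calc Q.avg (fun x => w x ^ (1 + δ))
      ≤ (volume Q.toSet)⁻¹ * (l ^ δ * (2 * ∫⁻ y in Q.toSet, w y)) := mul_le_mul_right hint _
    _ = 2 * (l ^ δ * l) := by
        rw [hl]
        unfold avg
        ring
    _ = _ := by
        rw [ENNReal.rpow_add_of_nonneg _ _ zero_le_one hδ0.le, ENNReal.rpow_one, mul_comm l]

/-- At `δ = 0` the expression equals `2 - 1 / (2 * A) < 2`, so continuity gives one positive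
exponent, and monotonicity in `δ` covers all smaller ones. -/
theorem exists_reverse_holder_exponent (d : ℕ) {A : ℝ} (hA : 1 ≤ A) :
    ∃ ε : ℝ, 0 < ε ∧ ∀ δ, δ ≤ ε → (2 * 3 ^ d : ℝ) ^ δ * (2 - 1 / (2 * A)) ≤ 2 := by
  have hA0 : 0 < 1 / (2 * A) := by positivity
  have hA2 : 1 / (2 * A) ≤ 1 := by
    rw [div_le_one (by linarith)]
    linarith
  have ha : (0 : ℝ) < 2 * 3 ^ d := by positivity
  have ha1 : (1 : ℝ) ≤ 2 * 3 ^ d := by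
    have : (1 : ℝ) ≤ 3 ^ d := one_le_pow₀ (by norm_num)
    linarith
  have hcont : Tendsto (fun δ : ℝ => (2 * 3 ^ d : ℝ) ^ δ * (2 - 1 / (2 * A))) (𝓝[>] 0)
      (𝓝 ((2 * 3 ^ d : ℝ) ^ (0 : ℝ) * (2 - 1 / (2 * A)))) :=
    ((Real.continuousAt_const_rpow ha.ne').tendsto.mul_const _).mono_left nhdsWithin_le_nhds
  rw [Real.rpow_zero, one_mul] at hcont
  obtain ⟨ε, h1, h2⟩ := ((hcont.eventually (gt_mem_nhds (by linarith : 2 - 1 / (2 * A) < 2))).and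
    self_mem_nhdsWithin).exists
  refine ⟨ε, h2, fun δ hδ => le_trans ?_ h1.le⟩
  have : (2 * 3 ^ d : ℝ) ^ δ ≤ (2 * 3 ^ d) ^ ε := Real.rpow_le_rpow_of_exponent_le ha1 hδ
  nlinarith

end Cube

/-! ### Domination calculus in a quasi-Banach function space. -/

namespace FunctionSpace

variable {𝕜 : Type*} [RCLike 𝕜]

section Domination

variable {Ω : Type*} [MeasurableSpace Ω] {μ : Measure Ω} {X : FunctionSpace 𝕜 μ}
  {F G : Ω → ℝ≥0∞} {a c : ℝ}

/-- `F` is dominated by an element of `X` of quasi-norm at most `c`. -/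
def Dominates (X : FunctionSpace 𝕜 μ) (F : Ω → ℝ≥0∞) (c : ℝ) : Prop :=
  ∃ g ∈ X.carrier, X.qnorm g ≤ c ∧ ∀ᵐ x ∂μ, F x ≤ ‖g x‖ₑ

/-- The class of a `[0, ∞]`-valued function, seen as a scalar function. -/
noncomputable def ofENNReal (𝕜 : Type*) [RCLike 𝕜] {μ : Measure Ω} (F : Ω → ℝ≥0∞)
    (hF : Measurable F) : Ω →ₘ[μ] 𝕜 :=
  AEEqFun.mk (fun x => (((F x).toReal : ℝ) : 𝕜))
    (RCLike.measurable_ofReal.comp hF.ennreal_toReal).aestronglyMeasurable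

theorem coeFn_ofENNReal (hF : Measurable F) :
    ⇑(ofENNReal 𝕜 F hF : Ω →ₘ[μ] 𝕜) =ᵐ[μ] fun x => (((F x).toReal : ℝ) : 𝕜) :=
  AEEqFun.coeFn_mk _ _

theorem enorm_ofReal_toReal {t : ℝ≥0∞} (ht : t ≠ ∞) : ‖((t.toReal : ℝ) : 𝕜)‖ₑ = t := by
  rw [← ofReal_norm, RCLike.norm_ofReal, abs_of_nonneg ENNReal.toReal_nonneg,
    ENNReal.ofReal_toReal ht]

theorem Dominates.mono (h : X.Dominates F c) (hGF : ∀ᵐ x ∂μ, G x ≤ F x) (hca : c ≤ a) :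
    X.Dominates G a := by
  obtain ⟨g, hg, hc, hF⟩ := h
  exact ⟨g, hg, hc.trans hca, by filter_upwards [hF, hGF] with x h1 h2 using h2.trans h1⟩

theorem dominates_self {g : Ω →ₘ[μ] 𝕜} (hg : g ∈ X.carrier) :
    X.Dominates (fun x => ‖g x‖ₑ) (X.qnorm g) :=
  ⟨g, hg, le_rfl, ae_of_all _ fun _ => le_rfl⟩

theorem Dominates.ae_ne_top (h : X.Dominates F c) : ∀ᵐ x ∂μ, F x ≠ ∞ := by
  obtain ⟨g, -, -, hF⟩ := h
  filter_upwards [hF] with x hx using ne_top_of_le_ne_top enorm_ne_top hx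

theorem ae_enorm_ofENNReal (hF : Measurable F) (h : ∀ᵐ x ∂μ, F x ≠ ∞) :
    ∀ᵐ x ∂μ, ‖(ofENNReal 𝕜 F hF : Ω →ₘ[μ] 𝕜) x‖ₑ = F x := by
  filter_upwards [coeFn_ofENNReal (𝕜 := 𝕜) hF, h] with x hx ht
  rw [hx, enorm_ofReal_toReal ht]

namespace IsQuasiBanach

theorem mem_of_dominates (hX : X.IsQuasiBanach) (h : X.Dominates F c) {g : Ω →ₘ[μ] 𝕜} (hg : ∀ᵐ x ∂μ, ‖g x‖ₑ ≤ F x) :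
    g ∈ X.carrier ∧ X.qnorm g ≤ c := by
  obtain ⟨f, hf, hc, hF⟩ := h
  have := hX.ideal f hf g (by
    filter_upwards [hF, hg] with x h1 h2
    exact enorm_le_iff_norm_le.1 (h2.trans h1))
  exact ⟨this.1, this.2.trans hc⟩

theorem ofENNReal_mem (hX : X.IsQuasiBanach) (h : X.Dominates F c) (hF : Measurable F) :
    ofENNReal 𝕜 F hF ∈ X.carrier ∧ X.qnorm (ofENNReal 𝕜 F hF) ≤ c :=
  hX.mem_of_dominates h ((ae_enorm_ofENNReal hF h.ae_ne_top).mono fun _ hx => hx.le)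

theorem nonneg_of_dominates (hX : X.IsQuasiBanach) (h : X.Dominates F c) : 0 ≤ c := by
  obtain ⟨f, hf, hc, -⟩ := h
  exact (hX.qnorm_nonneg f hf).trans hc

theorem dominates_zero (hX : X.IsQuasiBanach) (hc : 0 ≤ c) : X.Dominates 0 c :=
  ⟨0, hX.zero_mem, by rwa [(hX.qnorm_eq_zero_iff 0 hX.zero_mem).2 rfl],
    ae_of_all _ fun _ => zero_le⟩

theorem dominates_add (hX : X.IsQuasiBanach) {K : ℝ} (hK : X.QuasiTriangle K) (hF : X.Dominates F a)
    (hG : X.Dominates G c) : X.Dominates (fun x => F x + G x) (K * (a + c)) := by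
  obtain ⟨f, hf, hfa, hFf⟩ := hF
  obtain ⟨g, hg, hgc, hGg⟩ := hG
  have mf : Measurable fun x => ‖f x‖ₑ := f.stronglyMeasurable.measurable.enorm
  have mg : Measurable fun x => ‖g x‖ₑ := g.stronglyMeasurable.measurable.enorm
  -- The majorants are replaced by their moduli, so that no cancellation occurs in the sum.
  have hf' := hX.ofENNReal_mem (dominates_self hf) mf
  have hg' := hX.ofENNReal_mem (dominates_self hg) mg
  refine ⟨_, hX.add_mem _ hf'.1 _ hg'.1, (hK.2 _ hf'.1 _ hg'.1).trans ?_, ?_⟩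
  · have := hK.1
    gcongr
    · exact hf'.2.trans hfa
    · exact hg'.2.trans hgc
  · filter_upwards [hFf, hGg, AEEqFun.coeFn_add (ofENNReal 𝕜 _ mf : Ω →ₘ[μ] 𝕜)
      (ofENNReal 𝕜 _ mg), coeFn_ofENNReal (𝕜 := 𝕜) mf, coeFn_ofENNReal (𝕜 := 𝕜) mg]
      with x h1 h2 h3 h4 h5
    rw [h3, Pi.add_apply, h4, h5, ← RCLike.ofReal_add, ← ENNReal.toReal_add enorm_ne_top
      enorm_ne_top, enorm_ofReal_toReal (by simp)]
    gcongr

theorem dominates_const_mul (hX : X.IsQuasiBanach) {s : ℝ} (hs : 0 ≤ s) (hF : X.Dominates F c) :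
    X.Dominates (fun x => ENNReal.ofReal s * F x) (s * c) := by
  obtain ⟨f, hf, hfc, hFf⟩ := hF
  have hn : ‖(s : 𝕜)‖ = s := by rw [RCLike.norm_ofReal, abs_of_nonneg hs]
  refine ⟨(s : 𝕜) • f, hX.smul_mem _ f hf, ?_, ?_⟩
  · rw [hX.qnorm_smul _ f hf, hn]
    gcongr
  · filter_upwards [hFf, AEEqFun.coeFn_smul (s : 𝕜) f] with x h1 h2
    rw [h2, Pi.smul_apply, enorm_smul, ← ofReal_norm (s : 𝕜), hn]
    gcongr

theorem qnorm_sub_comm (hX : X.IsQuasiBanach) {f g : Ω →ₘ[μ] 𝕜} (h : f - g ∈ X.carrier) :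
    X.qnorm (g - f) = X.qnorm (f - g) := by
  have := hX.qnorm_smul (-1) (f - g) h
  rwa [show (-1 : 𝕜) • (f - g) = g - f from (neg_one_smul 𝕜 (f - g)).trans (neg_sub f g),
    norm_neg, norm_one, one_mul] at this

theorem sub_mem (hX : X.IsQuasiBanach) {f g : Ω →ₘ[μ] 𝕜} (hf : f ∈ X.carrier) (hg : g ∈ X.carrier) :
    f - g ∈ X.carrier := by
  have := hX.add_mem f hf _ (hX.smul_mem (-1) g hg)
  rwa [show (-1 : 𝕜) • g = -g from neg_one_smul 𝕜 g, ← sub_eq_add_neg] at this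

theorem sum_mem (hX : X.IsQuasiBanach) {ι : Type*} (s : Finset ι) {u : ι → Ω →ₘ[μ] 𝕜} (hu : ∀ i, u i ∈ X.carrier) :
    ∑ i ∈ s, u i ∈ X.carrier := by
  classical
  induction s using Finset.induction_on with
  | empty => simpa using hX.zero_mem
  | insert i s hi ih =>
    rw [Finset.sum_insert hi]
    exact hX.add_mem _ (hu i) _ ih

/-- Definiteness of the quasi-norm replaces any continuity or Fatou property when passing to limits
below. -/
theorem ae_eq_zero_of_dominates (hX : X.IsQuasiBanach) (hF : Measurable F) (h : ∀ ε > 0, X.Dominates F ε) :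
    ∀ᵐ x ∂μ, F x = 0 := by
  have h1 := hX.ofENNReal_mem (h 1 one_pos) hF
  have h2 : X.qnorm (ofENNReal 𝕜 F hF) = 0 := by
    refine le_antisymm (le_of_forall_pos_le_add fun ε hε => ?_) (hX.qnorm_nonneg _ h1.1)
    rw [zero_add]
    exact (hX.ofENNReal_mem (h ε hε) hF).2
  have h3 := (hX.qnorm_eq_zero_iff _ h1.1).1 h2
  filter_upwards [ae_enorm_ofENNReal (𝕜 := 𝕜) hF (h 1 one_pos).ae_ne_top,
    AEEqFun.coeFn_zero (μ := μ) (β := 𝕜) (α := Ω)] with x hx h0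
  rw [← hx, h3, h0]
  simp

/-- Splitting off the first term costs a factor `K`, which the ratio `1 / (2 * K)` absorbs with half
to spare. The induction on the length is therefore uniform in the starting index `m`. -/
theorem qnorm_sum_geometric_le (hX : X.IsQuasiBanach) {K : ℝ} (hK : X.QuasiTriangle K) (hc : 0 ≤ c)
    {u : ℕ → Ω →ₘ[μ] 𝕜} (hu : ∀ k, u k ∈ X.carrier)
    (hq : ∀ k, X.qnorm (u k) ≤ (1 / (2 * K)) ^ k * c) (n : ℕ) :
    ∀ m, X.qnorm (∑ k ∈ Finset.range n, u (m + k)) ≤ 2 * K * c * (1 / (2 * K)) ^ m := by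
  have hK0 : 0 < K := zero_lt_one.trans_le hK.1
  induction n with
  | zero =>
    intro m
    rw [Finset.sum_range_zero, (hX.qnorm_eq_zero_iff 0 hX.zero_mem).2 rfl]
    positivity
  | succ n ih =>
    intro m
    rw [Finset.sum_range_succ']
    have h1 : ∑ k ∈ Finset.range n, u (m + (k + 1)) = ∑ k ∈ Finset.range n, u (m + 1 + k) :=
      Finset.sum_congr rfl fun k _ => by rw [add_assoc, add_comm 1 k]
    rw [h1]
    refine (hK.2 _ (hX.sum_mem _ fun k => hu _) _ (hu _)).trans ?_
    calc K * (X.qnorm (∑ k ∈ Finset.range n, u (m + 1 + k)) + X.qnorm (u (m + 0)))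
        ≤ K * (2 * K * c * (1 / (2 * K)) ^ (m + 1) + (1 / (2 * K)) ^ m * c) := by
          gcongr
          · exact ih (m + 1)
          · exact hq m
      _ = _ := by
          rw [pow_succ]
          field_simp
          ring

/-- The partial sums are Cauchy, and their limit `h` is the majorant. One factor `2 * K` comes from
the partial sums; a further `K` comes from comparing `h` with them, as the quasi-norm need not be
continuous. -/
theorem dominates_tsum (hX : X.IsQuasiBanach) {K : ℝ} (hK : X.QuasiTriangle K) {F : ℕ → Ω → ℝ≥0∞}
    (hFm : ∀ k, Measurable (F k)) (hF : ∀ k, X.Dominates (F k) ((1 / (2 * K)) ^ k * c)) :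
    X.Dominates (fun x => ∑' k, F k x) (2 * K ^ 2 * c) := by
  have hK0 : 0 < K := zero_lt_one.trans_le hK.1
  have hc : 0 ≤ c := by simpa using hX.nonneg_of_dominates (hF 0)
  set ρ : ℝ := 1 / (2 * K) with hρ
  have hρ0 : 0 ≤ ρ := by positivity
  have hρ1 : ρ < 1 := by
    rw [hρ, div_lt_one (by linarith)]
    linarith [hK.1]
  set u : ℕ → Ω →ₘ[μ] 𝕜 := fun k => ofENNReal 𝕜 (F k) (hFm k)
  have hu : ∀ k, u k ∈ X.carrier := fun k => (hX.ofENNReal_mem (hF k) (hFm k)).1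
  have hq : ∀ k, X.qnorm (u k) ≤ ρ ^ k * c := fun k => (hX.ofENNReal_mem (hF k) (hFm k)).2
  set S : ℕ → Ω →ₘ[μ] 𝕜 := fun n => ∑ k ∈ Finset.range n, u k with hS
  have hSm : ∀ n, S n ∈ X.carrier := fun n => hX.sum_mem _ hu
  have hblock : ∀ n m, n ≤ m → X.qnorm (S m - S n) ≤ 2 * K * c * ρ ^ n := by
    intro n m hnm
    obtain ⟨j, rfl⟩ := Nat.exists_eq_add_of_le hnm
    simp only [hS]
    rw [Finset.sum_range_add, add_sub_cancel_left]
    exact hX.qnorm_sum_geometric_le hK hc hu hq j n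
  have hlim : Tendsto (fun n => 2 * K * c * ρ ^ n) atTop (𝓝 0) := by
    simpa using (tendsto_pow_atTop_nhds_zero_of_lt_one hρ0 hρ1).const_mul (2 * K * c)
  obtain ⟨h, hh, hlimS⟩ := hX.complete S hSm fun ε hε => by
    obtain ⟨N, hN⟩ := ((hlim.eventually (gt_mem_nhds hε))).exists_forall_of_atTop
    refine ⟨N, fun m hm n hn => ?_⟩
    rcases le_total n m with hnm | hnm
    · exact (hblock n m hnm).trans_lt (hN n hn)
    · rw [hX.qnorm_sub_comm (hX.sub_mem (hSm n) (hSm m))]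
      exact (hblock m n hnm).trans_lt (hN m hm)
  refine ⟨h, hh, ?_, ?_⟩
  · have hle : ∀ n, X.qnorm h ≤ K * (X.qnorm (S n - h) + 2 * K * c) := by
      intro n
      have h1 := hK.2 _ (hX.sub_mem hh (hSm n)) _ (hSm n)
      rw [sub_add_cancel, hX.qnorm_sub_comm (hX.sub_mem (hSm n) hh)] at h1
      refine h1.trans ?_
      gcongr
      simpa [hS] using hX.qnorm_sum_geometric_le hK hc hu hq n 0
    have h2 : Tendsto (fun n => K * (X.qnorm (S n - h) + 2 * K * c)) atTop
        (𝓝 (K * (0 + 2 * K * c))) := (hlimS.add_const _).const_mul K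
    refine (ge_of_tendsto' h2 hle).trans (le_of_eq ?_)
    ring
  · have hSval : ∀ n, ∀ᵐ x ∂μ, ‖S n x‖ₑ = ∑ k ∈ Finset.range n, F k x := by
      intro n
      have h1 : ∀ n, ∀ᵐ x ∂μ, S n x = (((∑ k ∈ Finset.range n, F k x).toReal : ℝ) : 𝕜) := by
        intro n
        induction n with
        | zero =>
          filter_upwards [AEEqFun.coeFn_zero (μ := μ) (β := 𝕜) (α := Ω)] with x hx
          simp [hS, hx]
        | succ n ih =>
          filter_upwards [ih, AEEqFun.coeFn_add (S n) (u n), coeFn_ofENNReal (𝕜 := 𝕜) (hFm n),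
            ae_all_iff.2 fun k => (hF k).ae_ne_top] with x h1 h2 h3 h4
          have h5 : S (n + 1) = S n + u n := Finset.sum_range_succ _ _
          rw [h5, h2, Pi.add_apply, h1, h3, Finset.sum_range_succ,
            ENNReal.toReal_add (ENNReal.sum_ne_top.2 fun k _ => h4 k) (h4 n), RCLike.ofReal_add]
      filter_upwards [h1 n, ae_all_iff.2 fun k => (hF k).ae_ne_top] with x h1 h4
      rw [h1, enorm_ofReal_toReal (ENNReal.sum_ne_top.2 fun k _ => h4 k)]
    -- The excess of the `n`-th partial sum over `|h|` is at most `|S m - h|` for every `m ≥ n`.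
    -- These have quasi-norm tending to 0, so the excess vanishes a.e.
    have hle : ∀ n, ∀ᵐ x ∂μ, ∑ k ∈ Finset.range n, F k x ≤ ‖h x‖ₑ := by
      intro n
      have hm : Measurable fun x => (∑ k ∈ Finset.range n, F k x) - ‖h x‖ₑ :=
        (Finset.measurable_sum _ fun k _ => hFm k).sub h.stronglyMeasurable.measurable.enorm
      have h0 := hX.ae_eq_zero_of_dominates hm fun ε hε => by
        obtain ⟨m, hm1, hm2⟩ := ((hlimS.eventually (gt_mem_nhds hε)).and
          (eventually_ge_atTop n)).exists
        refine ⟨S m - h, hX.sub_mem (hSm m) hh, hm1.le, ?_⟩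
        filter_upwards [hSval m, AEEqFun.coeFn_sub (S m) h] with x h1 h2
        rw [h2, Pi.sub_apply, tsub_le_iff_right]
        calc ∑ k ∈ Finset.range n, F k x ≤ ∑ k ∈ Finset.range m, F k x :=
              Finset.sum_le_sum_of_subset (Finset.range_mono hm2)
          _ = ‖(S m x - h x) + h x‖ₑ := by rw [sub_add_cancel, h1]
          _ ≤ _ := enorm_add_le _ _
      filter_upwards [h0] with x hx
      exact tsub_eq_zero_iff_le.1 hx
    filter_upwards [ae_all_iff.2 hle] with x hx
    exact ENNReal.tsum_le_of_sum_range_le hx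

end IsQuasiBanach

end Domination

end FunctionSpace

/-! ### Sparse families. -/

section Sparse

variable {d : ℕ} {S : Set (Cube d)}

/-- The indexing need not be injective: a cube occurring for several indices keeps the set of just
one of them. This matters because one cube may be a stopping cube at several heights. -/
theorem isSparse_range {ι : Type*} {q : ι → Cube d} {E : ι → Set (Fin d → ℝ)}
    (hm : ∀ i, MeasurableSet (E i)) (hsub : ∀ i, E i ⊆ (q i).toSet)
    (hhalf : ∀ i, 1 / 2 * volume (q i).toSet ≤ volume (E i))
    (hdisj : Pairwise (Function.onFun Disjoint E)) : IsSparse (Set.range q) := by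
  classical
  have hch : ∀ Q : Cube d, ∃ E' : Set (Fin d → ℝ), ∀ _ : Q ∈ Set.range q,
      ∃ i, q i = Q ∧ E' = E i := by
    intro Q
    by_cases h : Q ∈ Set.range q
    · obtain ⟨i, hi⟩ := h
      exact ⟨E i, fun _ => ⟨i, hi, rfl⟩⟩
    · exact ⟨∅, fun h' => (h h').elim⟩
  choose E' hE' using hch
  refine ⟨E', fun Q hQ => ?_, fun Q hQ R hR hne => ?_⟩
  · obtain ⟨i, rfl, h⟩ := hE' Q hQ
    rw [h]
    exact ⟨hm i, hsub i, hhalf i⟩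
  · obtain ⟨i, rfl, h⟩ := hE' Q hQ
    obtain ⟨j, rfl, h'⟩ := hE' R hR
    rw [Function.onFun, h, h']
    exact hdisj fun hij => hne (by rw [hij])

theorem IsSparse.countable (hS : IsSparse S) : S.Countable := by
  obtain ⟨E, hE, hd⟩ := hS
  have h1 := Measure.countable_meas_pos_of_disjoint_iUnion (μ := (volume : Measure (Fin d → ℝ)))
    (As := fun Q : S => E Q) (fun Q => (hE Q Q.2).1)
    (fun Q R hne => hd Q.2 R.2 fun h => hne (Subtype.ext h))
  have h2 : {Q : S | 0 < volume (E Q)} = Set.univ := by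
    refine Set.eq_univ_of_forall fun Q => ?_
    refine lt_of_lt_of_le ?_ (hE Q Q.2).2.2
    exact ENNReal.mul_pos (by norm_num) Q.1.volume_toSet_ne_zero
  rw [h2, Set.countable_univ_iff] at h1
  exact Set.countable_coe_iff.1 h1

/-- The averaging operator of a collection of cubes on `[0, ∞]`-valued functions. -/
noncomputable def sparseOp (S : Set (Cube d)) (F : (Fin d → ℝ) → ℝ≥0∞) (x : Fin d → ℝ) : ℝ≥0∞ :=
  ∑' Q : S, Q.1.toSet.indicator (fun _ => Q.1.avg F) x

theorem measurable_sparseOp (hS : S.Countable) (F : (Fin d → ℝ) → ℝ≥0∞) :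
    Measurable (sparseOp S F) := by
  have : Countable S := Set.countable_coe_iff.2 hS
  exact Measurable.tsum fun Q => measurable_const.indicator Q.1.measurableSet_toSet

theorem sparseOp_mono {F G : (Fin d → ℝ) → ℝ≥0∞} (h : ∀ᵐ x, F x ≤ G x) (x : Fin d → ℝ) :
    sparseOp S F x ≤ sparseOp S G x :=
  ENNReal.tsum_le_tsum fun Q => Set.indicator_le_indicator (Q.1.avg_mono h)

theorem avg_le_sparseOp {Q : Cube d} (hQ : Q ∈ S) {x : Fin d → ℝ} (hx : x ∈ Q.toSet)
    (F : (Fin d → ℝ) → ℝ≥0∞) : Q.avg F ≤ sparseOp S F x := by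
  refine le_trans (le_of_eq ?_) (ENNReal.le_tsum (⟨Q, hQ⟩ : S))
  rw [Set.indicator_of_mem hx]

theorem isSparse_singleton (Q : Cube d) : IsSparse {Q} := by
  have := isSparse_range (ι := Unit) (q := fun _ => Q) (E := fun _ => Q.toSet)
    (fun _ => Q.measurableSet_toSet) (fun _ => le_rfl)
    (fun _ => mul_le_of_le_one_left zero_le (by norm_num))
    (fun i j h => (h (Subsingleton.elim i j)).elim)
  simpa using this

/-- Removing from each cell the cell one generation below leaves disjoint sets and loses the
fraction `3 ^ (-d)` of the volume, which is at most one half because `d ≥ 1`. -/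
theorem TriadicGrid.isSparse_chain (hd : 1 ≤ d) (L : TriadicGrid d) (x : Fin d → ℝ) (T : Set ℤ) :
    IsSparse (Set.range fun k : T => L.cell k x) := by
  have hmono : Monotone fun k => (L.cell k x).toSet := fun j k hjk =>
    L.cube_subset_cell hjk (L.mem_cell j x)
  refine isSparse_range (E := fun k : T => (L.cell k x).toSet \ (L.cell (k - 1) x).toSet)
    (fun k => (L.cell k x).measurableSet_toSet.diff (L.cell _ x).measurableSet_toSet)
    (fun k => Set.sdiff_subset) (fun k => ?_) ?_
  · have h1 := L.volume_cell_succ ((k : ℤ) - 1) x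
    rw [sub_add_cancel] at h1
    have h2 : (2 : ℝ≥0∞) ≤ 3 ^ d := by
      calc (2 : ℝ≥0∞) ≤ 3 ^ 1 := by norm_num
        _ ≤ 3 ^ d := pow_le_pow_right₀ (by norm_num) hd
    have hfin := (L.cell ((k : ℤ) - 1) x).volume_toSet_ne_top
    rw [measure_sdiff (hmono (by simp)) (L.cell _ x).measurableSet_toSet.nullMeasurableSet hfin]
    have h3 : 2 * volume (L.cell ((k : ℤ) - 1) x).toSet ≤ volume (L.cell k x).toSet := by
      rw [h1]
      gcongr
    refine ENNReal.le_sub_of_add_le_right hfin ?_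
    have h4 : volume (L.cell ((k : ℤ) - 1) x).toSet ≤ 1 / 2 * volume (L.cell k x).toSet := by
      calc _ = 1 / 2 * (2 * volume (L.cell ((k : ℤ) - 1) x).toSet) := by
            rw [← mul_assoc, one_div, ENNReal.inv_mul_cancel (by norm_num) (by norm_num), one_mul]
        _ ≤ _ := by gcongr
    calc _ ≤ 1 / 2 * volume (L.cell k x).toSet + 1 / 2 * volume (L.cell k x).toSet := by gcongr
      _ = _ := by rw [← add_mul, ENNReal.add_halves, one_mul]
  · have key : ∀ j k : T, (j : ℤ) < k → Disjoint
        ((L.cell j x).toSet \ (L.cell ((j : ℤ) - 1) x).toSet)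
        ((L.cell k x).toSet \ (L.cell ((k : ℤ) - 1) x).toSet) := by
      intro j k hjk
      refine Set.disjoint_left.2 fun y hy hy' => hy'.2 ?_
      exact hmono (show (j : ℤ) ≤ k - 1 by omega) hy.1
    intro j k hne
    rcases lt_or_gt_of_ne (fun h => hne (Subtype.ext h) : (j : ℤ) ≠ k) with h | h
    · exact key j k h
    · exact (key k j h).symm

/-- The stopping cubes at the heights `(2 * 3 ^ d) ^ n`, `n ∈ ℤ`, form a sparse collection. -/
theorem TriadicGrid.isSparse_stopping (L : TriadicGrid d) (F : (Fin d → ℝ) → ℝ≥0∞)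
    (hb : ∀ t, t ≠ 0 → ∀ x, BddAbove {k | t < (L.cell k x).avg F}) :
    IsSparse (Set.range fun i : {i : ℤ × (ℤ × (Fin d → ℤ)) //
      L.IsStopping F ((2 * 3 ^ d) ^ i.1) i.2} => L.cube i.1.2) := by
  set a : ℝ≥0∞ := 2 * 3 ^ d with ha
  have ha0 : a ≠ 0 := by positivity
  have ha1 : 1 ≤ a := by
    rw [ha]
    exact_mod_cast Nat.pos_of_ne_zero (by positivity : 2 * 3 ^ d ≠ 0)
  have hat : a ≠ ∞ := ENNReal.mul_ne_top (by norm_num) (ENNReal.pow_ne_top (by norm_num))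
  have hpow0 : ∀ n : ℤ, a ^ n ≠ 0 := fun n => (ENNReal.zpow_pos ha0 hat n).ne'
  have hsucc : ∀ n : ℤ, a ^ (n + 1) = 2 * 3 ^ d * a ^ n := fun n => by
    rw [ENNReal.zpow_add ha0 hat, zpow_one, mul_comm]
  -- Removing the superlevel set at the next height keeps half of each cube and separates different
  -- heights; at equal heights the stopping cubes are already disjoint.
  refine isSparse_range (E := fun i => (L.cube i.1.2).toSet \ L.superlevel F (a ^ (i.1.1 + 1)))
    (fun i => (L.cube _).measurableSet_toSet.diff (L.measurableSet_superlevel _ _))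
    (fun i => Set.sdiff_subset) (fun i => ?_) ?_
  · rw [hsucc]
    refine i.2.half_volume_le (hpow0 _) (ENNReal.zpow_ne_top ha0 hat _) (hb _ ?_)
    rw [← hsucc]
    exact hpow0 _
  · have key : ∀ i j : {i : ℤ × (ℤ × (Fin d → ℤ)) // L.IsStopping F (a ^ i.1) i.2},
        i.1.1 < j.1.1 → Disjoint
        ((L.cube i.1.2).toSet \ L.superlevel F (a ^ (i.1.1 + 1)))
        ((L.cube j.1.2).toSet \ L.superlevel F (a ^ (j.1.1 + 1))) := by
      intro i j hij
      refine Set.disjoint_left.2 fun y hy hy' => hy.2 ?_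
      exact L.superlevel_anti F (ENNReal.zpow_le_of_le ha1 (by omega : i.1.1 + 1 ≤ j.1.1))
        (j.2.subset_superlevel hy'.1)
    intro i j hne
    rcases lt_trichotomy i.1.1 j.1.1 with h | h | h
    · exact key i j h
    · refine Set.disjoint_left.2 fun y hy hy' => hne (Subtype.ext (Prod.ext h ?_))
      exact i.2.eq_of_mem (h ▸ j.2) hy.1 hy'.1
    · exact (key j i h).symm

end Sparse

/-! ### Maximal functions. -/

namespace TriadicGrid

variable {d : ℕ} (L : TriadicGrid d)

/-- The maximal function associated with a grid. -/
noncomputable def maximal (F : (Fin d → ℝ) → ℝ≥0∞) (x : Fin d → ℝ) : ℝ≥0∞ :=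
  ⨆ k, (L.cell k x).avg F

theorem measurable_maximal (F : (Fin d → ℝ) → ℝ≥0∞) : Measurable (L.maximal F) :=
  Measurable.iSup fun k => L.measurable_avg_cell k F

end TriadicGrid

/-- The supremum of the maximal functions associated with the standard shifted grids. -/
noncomputable def shiftedMaximal {d : ℕ} (F : (Fin d → ℝ) → ℝ≥0∞) (x : Fin d → ℝ) : ℝ≥0∞ :=
  ⨆ b : Fin d → Bool, (TriadicGrid.standard b).maximal F x

section Maximal

variable {d : ℕ}

theorem measurable_shiftedMaximal (F : (Fin d → ℝ) → ℝ≥0∞) : Measurable (shiftedMaximal F) :=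
  Measurable.iSup fun b => (TriadicGrid.standard b).measurable_maximal F

theorem avg_le_shiftedMaximal {Q : Cube d} {x : Fin d → ℝ} (hx : x ∈ Q.toSet)
    (F : (Fin d → ℝ) → ℝ≥0∞) : Q.avg F ≤ 6 ^ d * shiftedMaximal F x := by
  obtain ⟨b, p, hsub, hside⟩ := TriadicGrid.exists_standard_cube_superset Q
  have h1 := Cube.avg_le_of_subset hsub (by norm_num) hside F
  rw [ENNReal.ofReal_ofNat] at h1
  refine h1.trans ?_
  gcongr
  rw [← (TriadicGrid.standard b).cell_eq_of_mem (hsub hx)]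
  exact (le_iSup (fun k => ((TriadicGrid.standard b).cell k x).avg F) p.1).trans
    (le_iSup (fun b : Fin d → Bool => (TriadicGrid.standard b).maximal F x) b)

theorem avg_tsum {Q : Cube d} {F : ℕ → (Fin d → ℝ) → ℝ≥0∞} (hF : ∀ k, Measurable (F k))
    (s : ℕ → ℝ≥0∞) : Q.avg (fun x => ∑' k, s k * F k x) = ∑' k, s k * Q.avg (F k) := by
  unfold Cube.avg
  rw [lintegral_tsum fun k => ((hF k).const_mul _).aemeasurable, ← ENNReal.tsum_mul_left]
  congr 1
  funext k
  rw [lintegral_const_mul _ (hF k)]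
  ring

theorem shiftedMaximal_tsum_le {F : ℕ → (Fin d → ℝ) → ℝ≥0∞} (hF : ∀ k, Measurable (F k))
    (s : ℕ → ℝ≥0∞) (x : Fin d → ℝ) :
    shiftedMaximal (fun x => ∑' k, s k * F k x) x ≤ ∑' k, s k * shiftedMaximal (F k) x := by
  refine iSup_le fun b => iSup_le fun k => ?_
  rw [avg_tsum hF]
  refine ENNReal.tsum_le_tsum fun j => ?_
  gcongr
  exact (le_iSup (fun k => ((TriadicGrid.standard b).cell k x).avg (F j)) k).trans
    (le_iSup (fun b : Fin d → Bool => (TriadicGrid.standard b).maximal (F j) x) b)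

end Maximal

/-- Each term satisfies `a i ^ r = a i * a i ^ (r - 1) ≤ a i * (∑ a) ^ (r - 1)`. -/
theorem ENNReal.tsum_rpow_le {ι : Type*} (a : ι → ℝ≥0∞) {r : ℝ} (hr : 1 ≤ r) :
    ∑' i, a i ^ r ≤ (∑' i, a i) ^ r := by
  have hsplit : ∀ t : ℝ≥0∞, t ^ r = t * t ^ (r - 1) := fun t => by
    conv_lhs => rw [← add_sub_cancel 1 r]
    rw [ENNReal.rpow_add_of_nonneg _ _ zero_le_one (by linarith), ENNReal.rpow_one]
  rw [hsplit, ← ENNReal.tsum_mul_right]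
  refine ENNReal.tsum_le_tsum fun i => ?_
  rw [hsplit]
  have h := ENNReal.le_tsum (f := a) i
  exact mul_le_mul' le_rfl (ENNReal.rpow_le_rpow h (by linarith))

/-! ### From the sparse bound to maximal bounds and `A₁` majorants. -/

namespace FunctionSpace

variable {𝕜 : Type*} [RCLike 𝕜] {d : ℕ} {X : FunctionSpace 𝕜 (volume : Measure (Fin d → ℝ))}
  {F : (Fin d → ℝ) → ℝ≥0∞} {C K c : ℝ}

theorem SparseBound.dominates (hC0 : 0 ≤ C) (hC : X.SparseBound C) {S : Set (Cube d)}
    (hS : IsSparse S) (hF : X.Dominates F c) : X.Dominates (sparseOp S F) (C * c) := by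
  obtain ⟨f, hf, hfc, hFf⟩ := hF
  obtain ⟨g, hg, hgf, hgc⟩ := hC S hS f hf
  refine ⟨g, hg, hgc.trans (by gcongr), ?_⟩
  filter_upwards [hgf] with x hx
  rw [hx.2, enorm_ofReal_toReal hx.1]
  exact sparseOp_mono hFf x

/-- A single cube is a sparse family, and an infinite average would make its operator infinite on a
set of positive measure. -/
theorem SparseBound.avg_ne_top (hC0 : 0 ≤ C) (hC : X.SparseBound C) (hF : X.Dominates F c)
    (Q : Cube d) : Q.avg F ≠ ∞ := by
  have h1 := (hC.dominates hC0 (isSparse_singleton Q) hF).ae_ne_top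
  intro h
  refine Q.volume_toSet_ne_zero (measure_mono_null (fun x hx => ?_) (ae_iff.1 h1))
  exact not_not.2 (top_le_iff.1 (h ▸ avg_le_sparseOp (Set.mem_singleton Q) hx F))

/-- Infinitely many large cells with average above `t` would form a sparse chain whose operator is
infinite on a whole cube. This provides the maximal cubes without assuming `F` integrable. -/
theorem SparseBound.bddAbove (hd : 1 ≤ d) (hC0 : 0 ≤ C) (hC : X.SparseBound C)
    (hF : X.Dominates F c) (L : TriadicGrid d) {t : ℝ≥0∞} (ht : t ≠ 0) (x : Fin d → ℝ) :
    BddAbove {k | t < (L.cell k x).avg F} := by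
  by_contra hb
  -- Only generations `k ≥ 0` are kept, so that every cube of the chain contains the cell of
  -- generation 0.
  set T : Set ℤ := {k | 0 ≤ k ∧ t < (L.cell k x).avg F} with hT
  have hTi : T.Infinite := by
    refine Set.infinite_of_not_bddAbove fun ⟨b, hb'⟩ => hb ⟨max b 0, fun k hk => ?_⟩
    rcases le_or_gt 0 k with h | h
    · exact le_max_of_le_left (hb' ⟨h, hk⟩)
    · exact le_max_of_le_right h.le
  set S := Set.range fun k : T => L.cell k x
  have hSi : Infinite S := by
    have : Infinite T := hTi.to_subtype
    have hinj : Function.Injective fun k : T => L.cell k x := fun j k h =>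
      Subtype.ext (L.cell_injective_left x h)
    exact (Set.infinite_range_of_injective hinj).to_subtype
  have h1 := (hC.dominates hC0 (L.isSparse_chain hd x T) hF).ae_ne_top
  refine (L.cell 0 x).volume_toSet_ne_zero (measure_mono_null (fun y hy => ?_) (ae_iff.1 h1))
  refine not_not.2 (top_le_iff.1 ?_)
  rw [← ENNReal.tsum_const_eq_top_of_ne_zero (α := S) ht]
  refine ENNReal.tsum_le_tsum ?_
  rintro ⟨_, ⟨k, hk⟩, rfl⟩
  rw [Set.indicator_of_mem (L.cube_subset_cell (p := (0, L.idx 0 x)) hk.1 (L.mem_cell 0 x) hy)]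
  exact hk.2.le

/-- The maximal function is at most `2 * 3 ^ d` times the sparse operator of the stopping cubes: an
average lying between consecutive powers of `2 * 3 ^ d` puts the point in a stopping cube at the
lower height. -/
theorem SparseBound.dominates_maximal (hX : X.IsQuasiBanach) (hd : 1 ≤ d) (hC0 : 0 ≤ C)
    (hC : X.SparseBound C) (hF : X.Dominates F c) (L : TriadicGrid d) :
    X.Dominates (L.maximal F) (2 * 3 ^ d * (C * c)) := by
  obtain ⟨S, hS, hmem⟩ : ∃ S : Set (Cube d), IsSparse S ∧
      ∀ (n : ℤ) p, L.IsStopping F ((2 * 3 ^ d) ^ n) p → L.cube p ∈ S :=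
    ⟨_, L.isSparse_stopping F fun t ht => hC.bddAbove hd hC0 hF L ht,
      fun n p hp => ⟨⟨(n, p), hp⟩, rfl⟩⟩
  refine (hX.dominates_const_mul (by positivity : (0 : ℝ) ≤ 2 * 3 ^ d)
    (hC.dominates hC0 hS hF)).mono (ae_of_all _ fun x => iSup_le fun k => ?_) le_rfl
  have hofR : ENNReal.ofReal (2 * 3 ^ d) = 2 * 3 ^ d := by
    rw [ENNReal.ofReal_mul (by norm_num), ENNReal.ofReal_pow (by norm_num)]
    norm_num
  rw [hofR]
  set a : ℝ≥0∞ := 2 * 3 ^ d with ha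
  have ha1 : 1 < a := by
    have : (1 : ℝ≥0∞) ≤ 3 ^ d := one_le_pow₀ (by norm_num)
    calc (1 : ℝ≥0∞) < 2 * 1 := by norm_num
      _ ≤ a := by rw [ha]; gcongr
  have ha0 : a ≠ 0 := (zero_lt_one.trans ha1).ne'
  have hat : a ≠ ∞ := ENNReal.mul_ne_top (by norm_num) (ENNReal.pow_ne_top (by norm_num))
  rcases eq_or_ne ((L.cell k x).avg F) 0 with h0 | h0
  · rw [h0]
    exact zero_le
  obtain ⟨n, hn1, hn2⟩ := ENNReal.exists_mem_Ioc_zpow h0 (hC.avg_ne_top hC0 hF _) ha1 hat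
  obtain ⟨p, hp, hxp⟩ := TriadicGrid.exists_isStopping
    (hC.bddAbove hd hC0 hF L (ENNReal.zpow_pos ha0 hat n).ne' x) ⟨k, hn1⟩
  calc (L.cell k x).avg F ≤ a ^ (n + 1) := hn2
    _ = a * a ^ n := by rw [ENNReal.zpow_add ha0 hat, zpow_one, mul_comm]
    _ ≤ a * sparseOp S F x :=
      mul_le_mul_right (hp.1.le.trans (avg_le_sparseOp (hmem n p hp) hxp F)) a

/-- The supremum over the `2 ^ d` grids is bounded by the sum, at the cost of repeated factors `K`.
The size of `B` is harmless, since it affects only the range of `r`. -/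
theorem SparseBound.exists_shiftedMaximal_bound (hX : X.IsQuasiBanach) (hd : 1 ≤ d) (hC0 : 0 ≤ C)
    (hC : X.SparseBound C) : ∃ B : ℝ, 1 ≤ B ∧ ∀ (F : (Fin d → ℝ) → ℝ≥0∞) (c : ℝ),
      X.Dominates F c → X.Dominates (shiftedMaximal F) (B * c) := by
  classical
  obtain ⟨K, hK⟩ := hX.quasi_triangle
  have key : ∀ s : Finset (Fin d → Bool), ∃ B : ℝ, 0 ≤ B ∧ ∀ (F : (Fin d → ℝ) → ℝ≥0∞) (c : ℝ),
      X.Dominates F c →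
      X.Dominates (fun x => ∑ b ∈ s, (TriadicGrid.standard b).maximal F x) (B * c) := by
    intro s
    induction s using Finset.induction_on with
    | empty =>
      refine ⟨0, le_rfl, fun F c _ => ?_⟩
      rw [zero_mul]
      exact hX.dominates_zero le_rfl
    | insert b s hb ih =>
      obtain ⟨B, hB0, hB⟩ := ih
      refine ⟨K * (2 * 3 ^ d * C + B), ?_, fun F c hF => ?_⟩
      · have := zero_le_one.trans hK.1
        positivity
      · have h1 := hX.dominates_add hK
          (hC.dominates_maximal hX hd hC0 hF (TriadicGrid.standard b)) (hB F c hF)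
        refine h1.mono (ae_of_all _ fun x => ?_) (le_of_eq (by ring))
        rw [Finset.sum_insert hb]
  obtain ⟨B, hB0, hB⟩ := key Finset.univ
  refine ⟨max B 1, le_max_right _ _, fun F c hF => ?_⟩
  have hc := hX.nonneg_of_dominates hF
  refine (hB F c hF).mono (ae_of_all _ fun x => iSup_le fun b => ?_)
    (mul_le_mul_of_nonneg_right (le_max_left _ _) hc)
  exact Finset.single_le_sum (f := fun b => (TriadicGrid.standard b).maximal F x)
    (fun _ _ => zero_le) (Finset.mem_univ b)

/-- The Rubio de Francia algorithm: every element of `X` has an `A₁` majorant in `X`. -/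
theorem SparseBound.exists_A1_majorant (hX : X.IsQuasiBanach) (hd : 1 ≤ d) (hC0 : 0 ≤ C)
    (hC : X.SparseBound C) (hK : X.QuasiTriangle K) :
    ∃ A : ℝ, 1 ≤ A ∧ ∀ (F : (Fin d → ℝ) → ℝ≥0∞) (c : ℝ), Measurable F → X.Dominates F c →
      ∃ G : (Fin d → ℝ) → ℝ≥0∞, Measurable G ∧ (∀ x, F x ≤ G x) ∧
        X.Dominates G (2 * K ^ 2 * c) ∧
        ∀ (Q : Cube d), ∀ x ∈ Q.toSet, Q.avg G ≤ ENNReal.ofReal A * G x := by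
  obtain ⟨B, hB1, hB⟩ := hC.exists_shiftedMaximal_bound hX hd hC0
  have hK1 := hK.1
  have hKB : 1 ≤ 2 * K * B := by nlinarith
  refine ⟨6 ^ d * (2 * K * B), one_le_mul_of_one_le_of_one_le (one_le_pow₀ (by norm_num)) hKB,
    fun F c hFm hF => ?_⟩
  -- The factor `1 / B` offsets the growth of the iterates, and `1 / (2 * K)` is the ratio required
  -- by `dominates_tsum`.
  set s : ℝ := 1 / (2 * K * B) with hs
  have hs0 : 0 < s := by positivity
  set ρ : ℝ≥0∞ := ENNReal.ofReal s with hρ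
  set N : ℕ → (Fin d → ℝ) → ℝ≥0∞ := fun k => shiftedMaximal^[k] F with hN
  have hNs : ∀ k, N (k + 1) = shiftedMaximal (N k) := fun k =>
    Function.iterate_succ_apply' _ _ _
  have hNm : ∀ k, Measurable (N k) := by
    rintro (_ | k)
    · exact hFm
    · rw [hNs]
      exact measurable_shiftedMaximal _
  have hND : ∀ k, X.Dominates (N k) (B ^ k * c) := by
    intro k
    induction k with
    | zero => simpa [hN] using hF
    | succ k ih =>
      rw [hNs, pow_succ', mul_assoc]
      exact hB _ _ ih
  refine ⟨fun x => ∑' k, ρ ^ k * N k x, Measurable.tsum fun k => (hNm k).const_mul _,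
    fun x => ?_, ?_, fun Q x hx => ?_⟩
  · refine le_trans (le_of_eq ?_) (ENNReal.le_tsum 0)
    simp [hN]
  · refine hX.dominates_tsum hK (fun k => (hNm k).const_mul _) fun k => ?_
    have h1 := hX.dominates_const_mul (by positivity : 0 ≤ s ^ k) (hND k)
    rw [ENNReal.ofReal_pow hs0.le] at h1
    refine h1.mono (ae_of_all _ fun x => le_rfl) (le_of_eq ?_)
    rw [← mul_assoc, ← mul_pow, hs]
    congr 2
    field_simp
  · have h1 := (avg_le_shiftedMaximal hx (fun x => ∑' k, ρ ^ k * N k x)).trans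
      (mul_le_mul_right (shiftedMaximal_tsum_le hNm (fun k => ρ ^ k) x) _)
    refine h1.trans ?_
    have hr : ENNReal.ofReal (2 * K * B) * ρ = 1 := by
      rw [hρ, ← ENNReal.ofReal_mul (by linarith), hs, mul_one_div_cancel (by linarith),
        ENNReal.ofReal_one]
    have h6 : ENNReal.ofReal (6 ^ d * (2 * K * B)) = 6 ^ d * ENNReal.ofReal (2 * K * B) := by
      rw [ENNReal.ofReal_mul (by positivity), ENNReal.ofReal_pow (by norm_num)]
      norm_num
    rw [h6, mul_assoc]
    gcongr
    -- Applying the maximal function shifts the series by one index, at the price of `ρ⁻¹ = 2 * K *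
    -- B`.
    calc ∑' k, ρ ^ k * shiftedMaximal (N k) x
        = ENNReal.ofReal (2 * K * B) * ∑' k, ρ ^ (k + 1) * N (k + 1) x := by
          rw [← ENNReal.tsum_mul_left]
          congr 1
          funext k
          calc _ = ENNReal.ofReal (2 * K * B) * ρ * (ρ ^ k * N (k + 1) x) := by
                rw [hr, one_mul, hNs]
            _ = _ := by ring
      _ ≤ _ := by
          gcongr
          exact ENNReal.tsum_comp_le_tsum_of_injective (add_left_injective 1) _

/-! ### Concavification and conclusion. -/

theorem ae_enorm_absPow {Ω : Type*} [MeasurableSpace Ω] {μ : Measure Ω} {s : ℝ} (hs : 0 ≤ s)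
    (f : Ω →ₘ[μ] 𝕜) : ∀ᵐ x ∂μ, ‖absPow s f x‖ₑ = ‖f x‖ₑ ^ s := by
  filter_upwards [AEEqFun.coeFn_compMeasurable (fun t : 𝕜 => ((‖t‖ ^ s : ℝ) : 𝕜))
    (RCLike.measurable_ofReal.comp (measurable_norm.pow_const s)) f] with x hx
  rw [absPow, hx, Function.comp_apply, ← ofReal_norm, RCLike.norm_ofReal,
    abs_of_nonneg (by positivity), ← ENNReal.ofReal_rpow_of_nonneg (norm_nonneg _) hs, ofReal_norm]

/-- The constant `C₀` is used only to fix `A` and then `r₀`. The estimate afterwards holds for every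
admissible `C`, which allows passing to the infimum with `r₀` fixed. -/
theorem SparseBound.exists_concavification (hX : X.IsQuasiBanach) (hd : 1 ≤ d) {C₀ : ℝ}
    (hC₀ : 0 ≤ C₀) (hS₀ : X.SparseBound C₀) (hK : X.QuasiTriangle K) :
    ∃ r₀ : ℝ, 1 < r₀ ∧ ∀ r : ℝ, 1 < r → r ≤ r₀ → ∀ C : ℝ, 0 < C → X.SparseBound C →
      (X.concavification r).SparseBound ((4 * K ^ 2 * C) ^ r) := by
  obtain ⟨A, hA1, hA⟩ := hS₀.exists_A1_majorant hX hd hC₀ hK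
  obtain ⟨ε, hε0, hε⟩ := Cube.exists_reverse_holder_exponent d hA1
  refine ⟨1 + ε, by linarith, fun r hr1 hr C hC0 hC S hS f hf => ?_⟩
  have hr0 : 0 < r := by linarith
  have hri : 0 ≤ 1 / r := by positivity
  have hri1 : 1 / r ≤ 1 := by
    rw [div_le_one hr0]
    exact hr1.le
  have hfm : Measurable fun x => ‖f x‖ₑ := f.stronglyMeasurable.measurable.enorm
  set c := X.qnorm (absPow (1 / r) f) with hc
  have hc0 : 0 ≤ c := hX.qnorm_nonneg _ hf
  have hF : X.Dominates (fun x => ‖f x‖ₑ ^ (1 / r)) c := by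
    refine (dominates_self (X := X) hf).mono ?_ le_rfl
    filter_upwards [ae_enorm_absPow hri f] with x hx using hx.ge
  obtain ⟨G, hGm, hFG, hG, hGA⟩ := hA _ c (hfm.pow_const _) hF
  have hfG : ∀ x, ‖f x‖ₑ ≤ G x ^ r := fun x => by
    have := ENNReal.rpow_le_rpow (hFG x) hr0.le
    rwa [← ENNReal.rpow_mul, one_div_mul_cancel hr0.ne', ENNReal.rpow_one] at this
  have hRH : ∀ Q : Cube d, Q.avg (fun x => ‖f x‖ₑ) ≤ 2 * Q.avg G ^ r := fun Q => by
    have h1 := Cube.avg_rpow_le_of_A1 (Q := Q) hA1 hGA hGm (hC.avg_ne_top hC0.le hG Q)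
      (δ := r - 1) (by linarith) (hε _ (by linarith))
    rw [add_sub_cancel] at h1
    exact (Q.avg_mono (ae_of_all _ hfG)).trans h1
  set H := avgOp S f with hH
  have hHm : Measurable H := measurable_sparseOp hS.countable _
  -- Reverse Hölder on each cube, then `ℓ¹ ⊆ ℓ^r` to take the power out of the sum.
  have hHle : ∀ x, H x ≤ 2 * sparseOp S G x ^ r := fun x => by
    calc H x ≤ ∑' Q : S, 2 * (Q.1.toSet.indicator (fun _ => Q.1.avg G) x) ^ r := by
          refine ENNReal.tsum_le_tsum fun Q => ?_
          by_cases hx : x ∈ Q.1.toSet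
          · rw [Set.indicator_of_mem hx, Set.indicator_of_mem hx]
            exact hRH Q
          · rw [Set.indicator_of_notMem hx]
            exact zero_le
      _ ≤ _ := by
          rw [ENNReal.tsum_mul_left]
          gcongr
          exact ENNReal.tsum_rpow_le _ hr1.le
  have hHr : ∀ x, H x ^ (1 / r) ≤ ENNReal.ofReal 2 * sparseOp S G x := fun x => by
    calc H x ^ (1 / r) ≤ (2 * sparseOp S G x ^ r) ^ (1 / r) := ENNReal.rpow_le_rpow (hHle x) hri
      _ = 2 ^ (1 / r) * sparseOp S G x := by
          rw [ENNReal.mul_rpow_of_nonneg _ _ hri, ← ENNReal.rpow_mul,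
            mul_one_div_cancel hr0.ne', ENNReal.rpow_one]
      _ ≤ _ := by
          gcongr
          calc (2 : ℝ≥0∞) ^ (1 / r) ≤ 2 ^ (1 : ℝ) :=
                ENNReal.rpow_le_rpow_of_exponent_le (by norm_num) hri1
            _ = ENNReal.ofReal 2 := by norm_num
  have hHD : X.Dominates (fun x => H x ^ (1 / r)) (4 * K ^ 2 * C * c) :=
    (hX.dominates_const_mul zero_le_two (hC.dominates hC0.le hS hG)).mono (ae_of_all _ hHr)
      (le_of_eq (by ring))
  have hHt : ∀ᵐ x, H x ≠ ∞ := by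
    filter_upwards [hHD.ae_ne_top] with x hx h
    rw [h, ENNReal.top_rpow_of_pos (by positivity)] at hx
    exact hx rfl
  have hmem := hX.mem_of_dominates (g := absPow (1 / r) (ofENNReal 𝕜 H hHm)) hHD (by
    filter_upwards [ae_enorm_absPow hri (ofENNReal 𝕜 H hHm : (Fin d → ℝ) →ₘ[volume] 𝕜),
      ae_enorm_ofENNReal (𝕜 := 𝕜) hHm hHt] with x h1 h2
    rw [h1, h2])
  refine ⟨ofENNReal 𝕜 H hHm, hmem.1, ?_, ?_⟩
  · filter_upwards [hHt, coeFn_ofENNReal (𝕜 := 𝕜) hHm] with x h1 h2 using ⟨h1, h2⟩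
  · change X.qnorm (absPow (1 / r) (ofENNReal 𝕜 H hHm)) ^ r ≤ (4 * K ^ 2 * C) ^ r * c ^ r
    rw [← Real.mul_rpow (by positivity) hc0]
    exact Real.rpow_le_rpow (hX.qnorm_nonneg _ hmem.1) hmem.2 hr0.le

/-- The infimum is attained because, for fixed `f` and `g`, the inequality is closed in the
constant. -/
theorem IsQuasiBanach.quasiTriangle_quasiConst (hX : X.IsQuasiBanach) :
    X.QuasiTriangle X.quasiConst := by
  have hne : {K : ℝ | X.QuasiTriangle K}.Nonempty := hX.quasi_triangle
  refine ⟨le_csInf hne fun K hK => hK.1, fun f hf g hg => ?_⟩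
  have hs : 0 ≤ X.qnorm f + X.qnorm g := add_nonneg (hX.qnorm_nonneg f hf) (hX.qnorm_nonneg g hg)
  refine le_of_forall_pos_le_add fun ε hε => ?_
  set s := X.qnorm f + X.qnorm g
  obtain ⟨K, hK, hlt⟩ := exists_lt_of_csInf_lt hne
    (lt_add_of_pos_right X.quasiConst (by positivity : 0 < ε / (s + 1)))
  calc X.qnorm (f + g) ≤ K * s := hK.2 f hf g hg
    _ ≤ (X.quasiConst + ε / (s + 1)) * s := by gcongr
    _ = X.quasiConst * s + ε * (s / (s + 1)) := by ring
    _ ≤ X.quasiConst * s + ε * 1 := by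
      gcongr
      rw [div_le_one (by linarith)]
      linarith
    _ = _ := by ring

end FunctionSpace

theorem mainTheorem6 :
    ∃ c : ℕ → ℝ → ℝ, (∀ d K, 0 < c d K) ∧
      ∀ (𝕜 : Type*) [RCLike 𝕜] (d : ℕ), 1 ≤ d →
        ∀ X : FunctionSpace 𝕜 (volume : Measure (Fin d → ℝ)),
          X.IsQuasiBanach → X.MemASparse →
          ∃ r₀ : ℝ, 1 < r₀ ∧ ∀ r : ℝ, 1 < r → r ≤ r₀ →
            (X.concavification r).MemASparse ∧
            (X.concavification r).aSparseConst ^ (1 / r) ≤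
              c d X.quasiConst * X.aSparseConst := by
  -- The summand 1 only keeps the constant positive for every real `K`, including 0.
  refine ⟨fun _ K => 4 * K ^ 2 + 1, fun _ K => by positivity,
    fun 𝕜 _ d hd X hX ⟨C₀, hC₀, hS₀⟩ => ?_⟩
  have hK := hX.quasiTriangle_quasiConst
  set K := X.quasiConst
  have hK0 : 0 < 4 * K ^ 2 := by
    have := hK.1
    positivity
  obtain ⟨r₀, hr₀, h⟩ := hS₀.exists_concavification hX hd hC₀.le hK
  refine ⟨r₀, hr₀, fun r hr1 hr => ⟨⟨_, by positivity, h r hr1 hr C₀ hC₀ hS₀⟩, ?_⟩⟩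
  have hr0 : 0 < r := by linarith
  have hle : ∀ C, 0 < C → X.SparseBound C →
      (X.concavification r).aSparseConst ^ (1 / r) ≤ 4 * K ^ 2 * C := by
    intro C hC hS
    have h1 : (X.concavification r).aSparseConst ≤ (4 * K ^ 2 * C) ^ r :=
      csInf_le ⟨0, fun _ hx => hx.1.le⟩ ⟨by positivity, h r hr1 hr C hC hS⟩
    have h2 : 0 ≤ (X.concavification r).aSparseConst := Real.sInf_nonneg fun _ hx => hx.1.le
    calc _ ≤ ((4 * K ^ 2 * C) ^ r) ^ (1 / r) := Real.rpow_le_rpow h2 h1 (by positivity)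
      _ = _ := by
        rw [← Real.rpow_mul (by positivity), mul_one_div_cancel hr0.ne', Real.rpow_one]
  have h3 : (X.concavification r).aSparseConst ^ (1 / r) / (4 * K ^ 2) ≤ X.aSparseConst := by
    refine le_csInf ⟨C₀, hC₀, hS₀⟩ fun C hC => ?_
    rw [div_le_iff₀ hK0]
    linarith [hle C hC.1 hC.2]
  have h4 : 0 ≤ X.aSparseConst := Real.sInf_nonneg fun _ hx => hx.1.le
  rw [div_le_iff₀ hK0] at h3
  linarith
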